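/- Let $(B(t))_{t\in\mathbb Z}$ be a centered, complex-valued, wide sense stationary sequence of square-integrable random variables with spectral measure $\mu$, i.e. $\mu$ is the finite measure on $[-\pi,\pi)$ with $\mathbb E\,B(t)\overline{B(0)}=\int_{[-\pi,\pi)} e^{itu}\,\mu(du)$ for all $t\in\mathbb Z$. Let $f_a$ be the density, with respect to Lebesgue measure, of the absolutely continuous part of $\mu$. Let $H$ be the closed linear span of $\{B(s):s\in\mathbb Z\}$ in $L_2$ and, for $t\in\mathbb Z$, let $H_t$ be the closed linear span of $\{B(s): s\le t\}$. The correspondence $e^{isu}\mapsto B(s)$ extends to a linear isometry of $L_2(\mu)$ onto $H$, written $\phi\mapsto\int\phi\,d\mathcal W$. Let $\ell:[-\pi,\pi)\to\mathbb C$ be measurable and let $L$ be the linear filter with frequency characteristic $\ell$: $L\left(\int\phi\,d\mathcal W\right)=\int \ell\phi\,d\mathcal W$, with domain $\mathcal D(L)=\left\{\int\phi\,d\mathcal W:\ \phi\in L_2(\mu),\ \int|\ell\phi|^2\,d\mu<\infty\right\}$. Put $$\sigma^2(t)=\inf_{Y\in H_t\cap\mathcal D(L)}\left\{\mathbb E|Y-B(0)|^2+\mathbb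 E|LY|^2\right\}\quad(t\in\mathbb Z),\qquad \sigma^2(\infty)=\inf_{Y\in H\cap\mathcal D(L)}\left\{\mathbb E|Y-B(0)|^2+\mathbb E|LY|^2\right\}.$$ Then for every fixed $t\in\mathbb Z$ the equality $\sigma^2(t)=\sigma^2(\infty)$ holds if and only if - either $\int_{-\pi}^{\pi}|\ln f_a(u)|\,du=\infty$ (where $|\ln 0|=\infty$), - or $\int_{-\pi}^{\pi}|\ln f_a(u)|\,du<\infty$ and $\frac1{1+|\ell(u)|^2}$ is a trigonometric polynomial of degree not exceeding $t$, i.e. there are $b_j\in\mathbb C$ with $\frac{1}{1+|\ell(u)|^2}=\sum_{|j|\le t}b_j e^{iju}$ for Lebesgue-a.e. $u\in[-\pi,\pi)$ (the sum being empty, hence $0$, if $t<0$). In particular, if $\int_{-\pi}^{\pi}|\ln f_a(u)|\,du<\infty$, then $\sigma^2(t)>\sigma^2(\infty)$ for every $t<0$, and $\sigma^2(0)=\sigma^2(\infty)$ holds if and only if $|\ell|$ is Lebesgue-a.e. on $[-\pi,\pi)$ equal to a constant. -/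

import Mathlib

open MeasureTheory Set Filter Topology
open scoped Real ENNReal ComplexConjugate

noncomputable section

/-! ### Wide sense stationary sequences -/

/-- A centered, wide sense stationary sequence of complex random variables on `(Ω, P)`:
`E B(t) = 0`, `E |B(t)|² < ∞`, and `E B(s+t) conj B(s)` does not depend on `s`. -/
structure StationarySequence {Ω : Type*} [MeasurableSpace Ω] (P : Measure Ω) where
  X : ℤ → Ω → ℂ
  memLp : ∀ t, MemLp (X t) 2 P
  centered : ∀ t, ∫ ω, X t ω ∂P = 0
  stationary : ∀ s t, ∫ ω, X (s + t) ω * conj (X s ω) ∂P = ∫ ω, X t ω * conj (X 0 ω) ∂P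

namespace StationarySequence

variable {Ω : Type*} [MeasurableSpace Ω] {P : Measure Ω}

/-- The random variable `B(t)` as an element of the Hilbert space `L²(P)`. -/
def val (B : StationarySequence P) (t : ℤ) : Lp ℂ 2 P := (B.memLp t).toLp (B.X t)

/-- `H(T)`, the closed linear span of `B(t)`, `t ∈ T`, in `L²(P)`. -/
def H (B : StationarySequence P) (T : Set ℤ) : Submodule ℂ (Lp ℂ 2 P) :=
  (Submodule.span ℂ (B.val '' T)).topologicalClosure

/-- `μ` is the spectral measure of `B`: a finite measure, carried by `[-π, π)`, with
`E B(t) conj B(0) = ∫ e^{itu} μ(du)` for all integers `t`. -/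
structure IsSpectralMeasure (B : StationarySequence P) (μ : Measure ℝ)
    [IsFiniteMeasure μ] : Prop where
  carried : μ (Ico (-π) π)ᶜ = 0
  cov : ∀ t : ℤ, ∫ ω, B.X t ω * conj (B.X 0 ω) ∂P =
    ∫ u, Complex.exp (Complex.I * t * u) ∂μ

end StationarySequence

/-! ### Exponentials in `L²(μ)` -/

theorem memLp_expI (μ : Measure ℝ) [IsFiniteMeasure μ] (t : ℤ) :
    MemLp (fun u : ℝ => Complex.exp (Complex.I * t * u)) 2 μ := by
  refine MemLp.of_bound (by fun_prop : Continuous _).aestronglyMeasurable 1 (ae_of_all _ ?_)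
  intro u
  have : Complex.I * t * u = ((t * u : ℝ) : ℂ) * Complex.I := by push_cast; ring
  rw [this, Complex.norm_exp_ofReal_mul_I]

/-- The exponential `u ↦ e^{itu}` as an element of `L²(μ)`. -/
def expLp (μ : Measure ℝ) [IsFiniteMeasure μ] (t : ℤ) : Lp ℂ 2 μ := (memLp_expI μ t).toLp _

/-- The exponentials span a dense subspace of `L²(μ)`. -/
theorem span_expLp_closure (μ : Measure ℝ) [IsFiniteMeasure μ] (hμ : μ (Ico (-π) π)ᶜ = 0) :
    (Submodule.span ℂ (range (expLp μ))).topologicalClosure = ⊤ := by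
  have : Fact (0 < 2 * π) := ⟨Real.two_pi_pos⟩
  let q : ℝ → AddCircle (2 * π) := fun u => (u : AddCircle (2 * π))
  have hq : Measurable q := AddCircle.measurable_mk'
  let ν := μ.map q
  have hqν : MeasurePreserving q μ ν := ⟨hq, rfl⟩
  have : IsFiniteMeasure ν := by dsimp only [ν]; infer_instance
  have hd : (Submodule.span ℂ (range (fun n : ℤ =>
      ContinuousMap.toLp 2 ν ℂ (fourier (T := 2 * π) n)))).topologicalClosure = ⊤ := by
    have h := (ContinuousMap.toLp_denseRange ℂ ν ℂ
      (by norm_num : (2 : ℝ≥0∞) ≠ ∞)).topologicalClosure_map_submodule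
      (span_fourier_closure_eq_top (T := 2 * π))
    rw [← h]
    congr 1
    refine (Submodule.span_eq_of_le _ ?_ ?_)
    · rintro _ ⟨n, rfl⟩
      exact Submodule.mem_map_of_mem (Submodule.subset_span (mem_range_self n))
    · rw [Submodule.map_le_iff_le_comap, Submodule.span_le]
      rintro _ ⟨n, rfl⟩
      exact Submodule.subset_span (mem_range_self n)
  let J : Lp ℂ 2 ν →ₗᵢ[ℂ] Lp ℂ 2 μ := Lp.compMeasurePreservingₗᵢ ℂ q hqν
  have hJe : ∀ n : ℤ, J (ContinuousMap.toLp 2 ν ℂ (fourier (T := 2 * π) n)) = expLp μ n := by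
    intro n
    apply Lp.ext
    have h1 := Lp.coeFn_compMeasurePreserving
      (ContinuousMap.toLp 2 ν ℂ (fourier (T := 2 * π) n)) hqν
    have h2 := hqν.quasiMeasurePreserving.ae_eq_comp
      (ContinuousMap.coeFn_toLp (p := 2) ν (𝕜 := ℂ) (fourier (T := 2 * π) n))
    have h3 := (memLp_expI μ n).coeFn_toLp
    refine (h1.trans h2).trans (EventuallyEq.trans (ae_of_all _ ?_) h3.symm)
    intro u
    simp only [Function.comp_apply, q, fourier_coe_apply]
    congr 1
    have : (π : ℂ) ≠ 0 := by exact_mod_cast Real.pi_ne_zero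
    push_cast
    field_simp
  have hJs : Function.Surjective J := by
    intro φ
    let s : AddCircle (2 * π) → ℝ := fun x => (AddCircle.measurableEquivIco (2 * π) (-π) x : ℝ)
    have hs : Measurable s := measurable_subtype_coe.comp (MeasurableEquiv.measurable _)
    have hsq : ∀ᵐ u ∂μ, s (q u) = u := by
      have : ∀ᵐ u ∂μ, u ∈ Ico (-π) π := hμ
      filter_upwards [this] with u hu
      have hu' : u ∈ Ico (-π) (-π + 2 * π) := ⟨hu.1, by linarith [hu.2]⟩
      exact AddCircle.equivIco_coe_of_mem hu'
    let φ' : ℝ → ℂ := (Lp.aestronglyMeasurable φ).mk φ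
    have hφ' : StronglyMeasurable φ' := (Lp.aestronglyMeasurable φ).stronglyMeasurable_mk
    have hφφ' : φ =ᵐ[μ] φ' := (Lp.aestronglyMeasurable φ).ae_eq_mk
    have hcomp : (φ' ∘ s) ∘ q =ᵐ[μ] φ := by
      filter_upwards [hsq, hφφ'] with u hu h2
      simp only [Function.comp_apply, hu, h2]
    have hg : MemLp (φ' ∘ s) 2 ν := by
      refine (memLp_map_measure_iff (hφ'.comp_measurable hs).aestronglyMeasurable
        hq.aemeasurable).2 ?_
      exact (Lp.memLp φ).ae_eq hcomp.symm
    refine ⟨hg.toLp _, ?_⟩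
    apply Lp.ext
    refine (Lp.coeFn_compMeasurePreserving (hg.toLp _) hqν).trans ?_
    exact (hqν.quasiMeasurePreserving.ae_eq_comp hg.coeFn_toLp).trans hcomp
  have hJd : DenseRange J.toContinuousLinearMap := hJs.denseRange
  have h := hJd.topologicalClosure_map_submodule hd
  rw [← h]
  congr 1
  refine (Submodule.span_eq_of_le _ ?_ ?_)
  · rintro _ ⟨n, rfl⟩
    rw [← hJe n]
    exact Submodule.mem_map_of_mem (Submodule.subset_span (mem_range_self n))
  · rw [Submodule.map_le_iff_le_comap, Submodule.span_le]
    rintro _ ⟨n, rfl⟩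
    exact Submodule.subset_span ⟨n, (hJe n).symm⟩

/-! ### The spectral isometry, linear filters, prediction errors -/

namespace StationarySequence

variable {Ω : Type*} [MeasurableSpace Ω] {P : Measure Ω}

theorem inner_val (B : StationarySequence P) {μ : Measure ℝ} [IsFiniteMeasure μ]
    (h : B.IsSpectralMeasure μ) (s t : ℤ) :
    inner ℂ (B.val s) (B.val t) = inner ℂ (expLp μ s) (expLp μ t) := by
  have h1 : inner ℂ (B.val s) (B.val t) = ∫ ω, B.X t ω * conj (B.X s ω) ∂P := by
    rw [L2.inner_def]
    refine integral_congr_ae ?_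
    filter_upwards [(B.memLp s).coeFn_toLp, (B.memLp t).coeFn_toLp] with ω h1 h2
    rw [val, val, h1, h2, RCLike.inner_apply]
  have h2 : inner ℂ (expLp μ s) (expLp μ t) =
      ∫ u : ℝ, Complex.exp (Complex.I * ((t - s : ℤ) : ℂ) * u) ∂μ := by
    rw [L2.inner_def]
    refine integral_congr_ae ?_
    filter_upwards [(memLp_expI μ s).coeFn_toLp, (memLp_expI μ t).coeFn_toLp] with u h1 h2
    rw [expLp, expLp, h1, h2, RCLike.inner_apply, ← Complex.exp_conj, ← Complex.exp_add]
    congr 1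
    simp only [map_mul, Complex.conj_I, Complex.conj_ofReal, map_intCast]
    push_cast
    ring
  have h3 := B.stationary s (t - s)
  rw [add_sub_cancel] at h3
  rw [h1, h2, h3, h.cov]

/-- The extension by linearity and continuity of `e^{itu} ↦ B(t)`. It is the stochastic integral
`φ ↦ ∫ φ dW` with respect to the orthogonal random measure `W` of `B`. -/
def stochIntCLM (B : StationarySequence P) (μ : Measure ℝ) [IsFiniteMeasure μ] :
    Lp ℂ 2 μ →L[ℂ] Lp ℂ 2 P :=
  (Finsupp.linearCombination ℂ B.val).extendOfNorm (Finsupp.linearCombination ℂ (expLp μ))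

theorem denseRange_linearCombination_expLp (μ : Measure ℝ) [IsFiniteMeasure μ]
    (hμ : μ (Ico (-π) π)ᶜ = 0) : DenseRange (Finsupp.linearCombination ℂ (expLp μ)) := by
  have h := span_expLp_closure μ hμ
  rw [← Finsupp.range_linearCombination] at h
  have h' := (Submodule.dense_iff_topologicalClosure_eq_top).2 h
  simpa only [DenseRange, LinearMap.coe_range] using h'

theorem norm_linearCombination (B : StationarySequence P) {μ : Measure ℝ} [IsFiniteMeasure μ]
    (h : B.IsSpectralMeasure μ) (x : ℤ →₀ ℂ) :
    ‖Finsupp.linearCombination ℂ B.val x‖ = ‖Finsupp.linearCombination ℂ (expLp μ) x‖ := by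
  have : inner ℂ (Finsupp.linearCombination ℂ B.val x) (Finsupp.linearCombination ℂ B.val x) =
      inner ℂ (Finsupp.linearCombination ℂ (expLp μ) x)
        (Finsupp.linearCombination ℂ (expLp μ) x) := by
    simp only [Finsupp.linearCombination_apply, Finsupp.sum, sum_inner, inner_sum,
      inner_smul_left, inner_smul_right, B.inner_val h]
  rw [@norm_eq_sqrt_re_inner ℂ, @norm_eq_sqrt_re_inner ℂ, this]

theorem stochIntCLM_expLp_comb (B : StationarySequence P) {μ : Measure ℝ} [IsFiniteMeasure μ]
    (h : B.IsSpectralMeasure μ) (x : ℤ →₀ ℂ) :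
    B.stochIntCLM μ (Finsupp.linearCombination ℂ (expLp μ) x) =
      Finsupp.linearCombination ℂ B.val x :=
  LinearMap.extendOfNorm_eq (denseRange_linearCombination_expLp μ h.carried)
    ⟨1, fun x => by rw [one_mul, B.norm_linearCombination h]⟩ x

theorem norm_stochIntCLM (B : StationarySequence P) {μ : Measure ℝ} [IsFiniteMeasure μ]
    (h : B.IsSpectralMeasure μ) (φ : Lp ℂ 2 μ) : ‖B.stochIntCLM μ φ‖ = ‖φ‖ := by
  refine (denseRange_linearCombination_expLp μ h.carried).induction_on
    (p := fun φ => ‖B.stochIntCLM μ φ‖ = ‖φ‖) φ ?_ ?_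
  · exact isClosed_eq (by fun_prop) (by fun_prop)
  · intro x
    rw [B.stochIntCLM_expLp_comb h, B.norm_linearCombination h]

/-- The stochastic integral as a linear isometry from `L²(μ)` to `L²(P)`. -/
def stochInt (B : StationarySequence P) {μ : Measure ℝ} [IsFiniteMeasure μ]
    (h : B.IsSpectralMeasure μ) : Lp ℂ 2 μ →ₗᵢ[ℂ] Lp ℂ 2 P where
  toLinearMap := (B.stochIntCLM μ).toLinearMap
  norm_map' := B.norm_stochIntCLM h

theorem stochInt_expLp (B : StationarySequence P) {μ : Measure ℝ} [IsFiniteMeasure μ]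
    (h : B.IsSpectralMeasure μ) (t : ℤ) : B.stochInt h (expLp μ t) = B.val t := by
  have := B.stochIntCLM_expLp_comb h (Finsupp.single t 1)
  rw [Finsupp.linearCombination_single, Finsupp.linearCombination_single, one_smul,
    one_smul] at this
  exact this

/-- The stochastic integrals are exactly the elements of `H = H(ℤ)`. -/
theorem range_stochInt (B : StationarySequence P) {μ : Measure ℝ} [IsFiniteMeasure μ]
    (h : B.IsSpectralMeasure μ) :
    LinearMap.range (B.stochInt h).toLinearMap = B.H univ := by
  apply le_antisymm
  · rintro _ ⟨φ, rfl⟩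
    refine (denseRange_linearCombination_expLp μ h.carried).induction_on
      (p := fun φ => B.stochInt h φ ∈ B.H univ) φ ?_ ?_
    · exact (Submodule.isClosed_topologicalClosure _).preimage (B.stochInt h).continuous
    · intro x
      have : B.stochInt h (Finsupp.linearCombination ℂ (expLp μ) x) =
        Finsupp.linearCombination ℂ B.val x := B.stochIntCLM_expLp_comb h x
      rw [this]
      apply Submodule.le_topologicalClosure
      rw [image_univ, ← Finsupp.range_linearCombination]
      exact LinearMap.mem_range_self _ x
  · refine Submodule.topologicalClosure_minimal _ ?_ ?_
    · rw [Submodule.span_le]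
      rintro _ ⟨t, -, rfl⟩
      exact ⟨expLp μ t, B.stochInt_expLp h t⟩
    · exact (B.stochInt h).isometry.isClosedEmbedding.isClosed_range

/-- The spectral isometry `φ ↦ ∫ φ dW` of `L²(μ)` onto `H`, with `e^{itu} ↦ B(t)`. -/
def spectralIso (B : StationarySequence P) {μ : Measure ℝ} [IsFiniteMeasure μ]
    (h : B.IsSpectralMeasure μ) : Lp ℂ 2 μ ≃ₗᵢ[ℂ] B.H univ :=
  (B.stochInt h).equivRange.trans (LinearIsometryEquiv.ofEq _ _ (B.range_stochInt h))

theorem coe_spectralIso (B : StationarySequence P) {μ : Measure ℝ} [IsFiniteMeasure μ]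
    (h : B.IsSpectralMeasure μ) (φ : Lp ℂ 2 μ) :
    (B.spectralIso h φ : Lp ℂ 2 P) = B.stochInt h φ := rfl

theorem spectralIso_expLp (B : StationarySequence P) {μ : Measure ℝ} [IsFiniteMeasure μ]
    (h : B.IsSpectralMeasure μ) (t : ℤ) :
    (B.spectralIso h (expLp μ t) : Lp ℂ 2 P) = B.val t := by
  rw [coe_spectralIso, stochInt_expLp]

end StationarySequence

/-- Multiplication by `ℓ` as an unbounded operator in `L²(μ)`, with its maximal domain
`{φ : ∫ |ℓ φ|² dμ < ∞}`. -/
def mulOp (μ : Measure ℝ) (ℓ : ℝ → ℂ) : Lp ℂ 2 μ →ₗ.[ℂ] Lp ℂ 2 μ where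
  domain :=
    { carrier := {φ | MemLp (fun u => ℓ u * φ u) 2 μ}
      zero_mem' := by
        refine (MemLp.zero (ε := ℂ)).ae_eq ?_
        filter_upwards [Lp.coeFn_zero ℂ 2 μ] with u hu
        simp only [hu, Pi.zero_apply, mul_zero]
      add_mem' := by
        intro φ ψ hφ hψ
        refine (MemLp.add hφ hψ).ae_eq ?_
        filter_upwards [Lp.coeFn_add φ ψ] with u hu
        simp only [hu, Pi.add_apply, mul_add]
      smul_mem' := by
        intro c φ hφ
        refine (MemLp.const_smul hφ c).ae_eq ?_
        filter_upwards [Lp.coeFn_smul c φ] with u hu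
        simp only [hu, Pi.smul_apply, smul_eq_mul, mul_left_comm] }
  toFun :=
    { toFun := fun φ => MemLp.toLp (fun u => ℓ u * φ.1 u) φ.2
      map_add' := by
        intro φ ψ
        rw [← MemLp.toLp_add]
        refine MemLp.toLp_congr _ _ ?_
        filter_upwards [Lp.coeFn_add φ.1 ψ.1] with u hu
        change ℓ u * (φ.1 + ψ.1 : Lp ℂ 2 μ) u = ℓ u * φ.1 u + ℓ u * ψ.1 u
        rw [hu, Pi.add_apply, mul_add]
      map_smul' := by
        intro c φ
        rw [RingHom.id_apply, ← MemLp.toLp_const_smul]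
        refine MemLp.toLp_congr _ _ ?_
        filter_upwards [Lp.coeFn_smul c φ.1] with u hu
        change ℓ u * (c • φ.1 : Lp ℂ 2 μ) u = c * (ℓ u * φ.1 u)
        rw [hu, Pi.smul_apply, smul_eq_mul, mul_left_comm] }

namespace StationarySequence

variable {Ω : Type*} [MeasurableSpace Ω] {P : Measure Ω}

/-- The linear filter `L (∫ φ dW) = ∫ ℓ φ dW` with frequency characteristic `ℓ`, an unbounded
operator in `H` with domain `{∫ φ dW : ∫ |ℓ φ|² dμ < ∞}`. -/
def linearFilter (B : StationarySequence P) {μ : Measure ℝ} [IsFiniteMeasure μ]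
    (h : B.IsSpectralMeasure μ) (ℓ : ℝ → ℂ) : B.H univ →ₗ.[ℂ] B.H univ where
  domain := (mulOp μ ℓ).domain.comap (B.spectralIso h).symm.toLinearEquiv.toLinearMap
  toFun :=
    { toFun := fun Y => B.spectralIso h (mulOp μ ℓ ⟨(B.spectralIso h).symm Y.1, Y.2⟩)
      map_add' := by
        intro Y Z
        rw [← map_add, ← LinearPMap.map_add]
        congr 2
        exact Subtype.ext (map_add _ _ _)
      map_smul' := by
        intro c Y
        rw [RingHom.id_apply, ← map_smul, ← LinearPMap.map_smul]
        congr 2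
        exact Subtype.ext (map_smul _ _ _) }

/-- The infimum of `E |Y - B(0)|² + E |L Y|²` over all `Y ∈ H(T)` in the domain of `L`, where `L`
is the linear filter with frequency characteristic `ℓ`. -/
def predictionError (B : StationarySequence P) {μ : Measure ℝ} [IsFiniteMeasure μ]
    (h : B.IsSpectralMeasure μ) (ℓ : ℝ → ℂ) (T : Set ℤ) : ℝ :=
  sInf {r : ℝ | ∃ Y : (B.linearFilter h ℓ).domain, (Y : Lp ℂ 2 P) ∈ B.H T ∧
    r = ‖(Y : Lp ℂ 2 P) - B.val 0‖ ^ 2 + ‖B.linearFilter h ℓ Y‖ ^ 2}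

end StationarySequence

/-! ### The conditions of the criterion -/

/-- `∫_{-π}^{π} |ln f_a(u)| du ∈ [0, ∞]`, where `f_a` is the density of the absolutely continuous
part of `μ` with respect to Lebesgue measure and `|ln 0| = ∞`. -/
def logIntegral (μ : Measure ℝ) : ℝ≥0∞ :=
  ∫⁻ u in Ico (-π) π, (ENNReal.log (μ.rnDeriv volume u)).abs

/-- `f` is Lebesgue-a.e. on `[-π, π)` equal to `∑_{|j| ≤ t} b_j e^{iju}` for some complex `b_j`
(an empty sum if `t < 0`). -/
def IsAETrigPoly (f : ℝ → ℂ) (t : ℤ) : Prop :=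
  ∃ b : ℤ → ℂ, ∀ᵐ u ∂volume.restrict (Ico (-π) π),
    f u = ∑ j ∈ Finset.Icc (-t) t, b j * Complex.exp (Complex.I * j * u)

end

/-! The spectral isometry turns the problem into one in `L²(μ)`: minimize `‖φ - 1‖² + ‖ℓφ‖²` over
the `φ` in the closed span of `e^{isu}`, `s ≤ t`, with `ℓφ ∈ L²(μ)`. Completing the square
(`error_eq`) shows that without the span restriction the minimizer is `η = 1/(1+|ℓ|²)` and that any
other `φ` costs `‖φ - η‖² + ‖ℓ(φ - η)‖²` more. As the span is closed, `σ²(t) = σ²(∞)` exactly when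
`η` lies in it (`predictionError_eq_minError_iff`).

Membership is decided by the innovation `g`, the component of `1` orthogonal to the strict past. If
`g = 0`, every half-line spans `L²(μ)`. If `g ≠ 0`, the functions `e^{inu} g` are orthogonal, so
`|g|² dμ` is a positive multiple of Lebesgue measure on `[-π, π)` (`sqMeasure_innov`). Testing a
bounded element of the span against these functions kills its Lebesgue-Fourier coefficients of index
above `t`; since `η` is real, those below `-t` vanish too, and `η` is a trigonometric polynomial.
Conversely, an equality that holds only Lebesgue-a.e. suffices, because functions vanishing
Lebesgue-a.e. lie in every half-line span (`mem_expSpan_of_ae_eq_zero`).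

It remains to see that `g ≠ 0` iff `ln f_a` is integrable, the qualitative part of Szegő's theorem.
Jensen's inequality for polynomials bounds the distance from `1` to the strict past below by the
geometric mean of `f_a`. In the other direction, `1/g` is in `L²` of Lebesgue measure, has no
frequencies above `0` and has nonzero mean, so Jensen's inequality makes `ln|1/g|` integrable, and
`f_a = c/|g|²`. -/

noncomputable section

/-! ### Closed spans of exponentials in `L²(μ)` -/

/-- The closed linear span of the exponentials `e^{isu}`, `s ∈ T`, in `L²(μ)`. -/
def expSpan (μ : Measure ℝ) [IsFiniteMeasure μ] (T : Set ℤ) : Submodule ℂ (Lp ℂ 2 μ) :=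
  (Submodule.span ℂ (expLp μ '' T)).topologicalClosure

instance completeSpace_expSpan (μ : Measure ℝ) [IsFiniteMeasure μ] (T : Set ℤ) :
    CompleteSpace (expSpan μ T) := by
  unfold expSpan; infer_instance

theorem isClosed_expSpan (μ : Measure ℝ) [IsFiniteMeasure μ] (T : Set ℤ) :
    IsClosed (expSpan μ T : Set (Lp ℂ 2 μ)) :=
  Submodule.isClosed_topologicalClosure _

theorem expLp_mem_expSpan (μ : Measure ℝ) [IsFiniteMeasure μ] {T : Set ℤ} {s : ℤ} (hs : s ∈ T) :
    expLp μ s ∈ expSpan μ T :=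
  Submodule.le_topologicalClosure _ (Submodule.subset_span (mem_image_of_mem _ hs))

theorem expSpan_le {μ : Measure ℝ} [IsFiniteMeasure μ] {T : Set ℤ}
    {K : Submodule ℂ (Lp ℂ 2 μ)} (hK : IsClosed (K : Set (Lp ℂ 2 μ)))
    (h : ∀ s ∈ T, expLp μ s ∈ K) : expSpan μ T ≤ K := by
  refine Submodule.topologicalClosure_minimal _ ?_ hK
  rw [Submodule.span_le]
  rintro _ ⟨s, hs, rfl⟩
  exact h s hs

theorem expSpan_mono (μ : Measure ℝ) [IsFiniteMeasure μ] {S T : Set ℤ} (h : S ⊆ T) :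
    expSpan μ S ≤ expSpan μ T :=
  expSpan_le (isClosed_expSpan μ T) fun _ hs => expLp_mem_expSpan μ (h hs)

theorem expSpan_univ (μ : Measure ℝ) [IsFiniteMeasure μ] (hμ : μ (Ico (-π) π)ᶜ = 0) :
    expSpan μ univ = ⊤ := by
  rw [expSpan, image_univ, span_expLp_closure μ hμ]

/-- A vector orthogonal to all generators is orthogonal to their closed span. -/
theorem inner_eq_zero_of_mem_expSpan {μ : Measure ℝ} [IsFiniteMeasure μ] {T : Set ℤ}
    {ψ φ : Lp ℂ 2 μ} (h : ∀ s ∈ T, inner ℂ ψ (expLp μ s) = 0) (hφ : φ ∈ expSpan μ T) :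
    inner ℂ ψ φ = 0 := by
  have : expSpan μ T ≤ (ℂ ∙ ψ)ᗮ :=
    expSpan_le (Submodule.isClosed_orthogonal _) fun s hs =>
      Submodule.mem_orthogonal_singleton_iff_inner_right.2 (h s hs)
  exact Submodule.mem_orthogonal_singleton_iff_inner_right.1 (this hφ)

theorem eq_zero_of_forall_inner_expLp {μ : Measure ℝ} [IsFiniteMeasure μ]
    (hμ : μ (Ico (-π) π)ᶜ = 0) {ψ : Lp ℂ 2 μ} (h : ∀ s, inner ℂ ψ (expLp μ s) = 0) : ψ = 0 := by
  have h1 : ψ ∈ expSpan μ univ := by rw [expSpan_univ μ hμ]; trivial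
  exact inner_self_eq_zero.1 (inner_eq_zero_of_mem_expSpan (fun s _ => h s) h1)

/-! ### Transport of the prediction problem to `L²(μ)` -/

namespace StationarySequence

variable {Ω : Type*} [MeasurableSpace Ω] {P : Measure Ω}

theorem H_eq_map (B : StationarySequence P) {μ : Measure ℝ} [IsFiniteMeasure μ]
    (h : B.IsSpectralMeasure μ) (T : Set ℤ) :
    B.H T = (expSpan μ T).map (B.stochInt h).toLinearMap := by
  apply SetLike.coe_injective
  rw [H, expSpan, Submodule.map_coe, Submodule.topologicalClosure_coe,
    Submodule.topologicalClosure_coe]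
  have h1 := (B.stochInt h).isometry.isClosedEmbedding.closure_image_eq
    (Submodule.span ℂ (expLp μ '' T) : Set (Lp ℂ 2 μ))
  change _ = (B.stochInt h) '' _
  rw [← h1]
  congr 1
  change _ = (B.stochInt h).toLinearMap '' _
  rw [← Submodule.map_coe, Submodule.map_span, image_image]
  congr 2
  exact image_congr fun t _ => (B.stochInt_expLp h t).symm

theorem stochInt_mem_H_iff (B : StationarySequence P) {μ : Measure ℝ} [IsFiniteMeasure μ]
    (h : B.IsSpectralMeasure μ) (T : Set ℤ) (φ : Lp ℂ 2 μ) :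
    B.stochInt h φ ∈ B.H T ↔ φ ∈ expSpan μ T := by
  rw [B.H_eq_map h]
  constructor
  · rintro ⟨ψ, hψ, he⟩
    exact (B.stochInt h).injective he ▸ hψ
  · exact fun hφ => ⟨φ, hφ, rfl⟩

/-- The prediction problem transported to the spectral domain. -/
theorem predictionError_eq (B : StationarySequence P) {μ : Measure ℝ} [IsFiniteMeasure μ]
    (h : B.IsSpectralMeasure μ) (ℓ : ℝ → ℂ) (T : Set ℤ) :
    B.predictionError h ℓ T = sInf {r : ℝ | ∃ φ : (mulOp μ ℓ).domain,
      (φ : Lp ℂ 2 μ) ∈ expSpan μ T ∧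
        r = ‖(φ : Lp ℂ 2 μ) - expLp μ 0‖ ^ 2 + ‖mulOp μ ℓ φ‖ ^ 2} := by
  rw [predictionError]
  congr 1
  have key : ∀ φ : Lp ℂ 2 μ, ‖B.stochInt h φ - B.val 0‖ = ‖φ - expLp μ 0‖ := by
    intro φ
    rw [← B.stochInt_expLp h 0, ← map_sub, LinearIsometry.norm_map]
  ext r
  constructor
  · rintro ⟨Y, hY, rfl⟩
    refine ⟨⟨(B.spectralIso h).symm Y.1, Y.2⟩, ?_, ?_⟩
    · rw [← B.stochInt_mem_H_iff h, ← coe_spectralIso, LinearIsometryEquiv.apply_symm_apply]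
      exact hY
    · rw [← key, ← coe_spectralIso, LinearIsometryEquiv.apply_symm_apply]
      congr 2
      exact LinearIsometryEquiv.norm_map (B.spectralIso h) _
  · rintro ⟨φ, hφ, rfl⟩
    have hd : (B.spectralIso h φ.1) ∈ (B.linearFilter h ℓ).domain := by
      change (B.spectralIso h).symm (B.spectralIso h φ.1) ∈ (mulOp μ ℓ).domain
      rw [LinearIsometryEquiv.symm_apply_apply]
      exact φ.2
    refine ⟨⟨_, hd⟩, ?_, ?_⟩
    · exact (B.stochInt_mem_H_iff h T φ).2 hφ
    · rw [← key, ← coe_spectralIso]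
      congr 2
      have : (⟨(B.spectralIso h).symm (B.spectralIso h φ.1), hd⟩ : (mulOp μ ℓ).domain) = φ :=
        Subtype.ext (LinearIsometryEquiv.symm_apply_apply _ _)
      have h2 : B.linearFilter h ℓ ⟨_, hd⟩ = B.spectralIso h (mulOp μ ℓ φ) := by
        conv_rhs => rw [← this]
        rfl
      rw [h2, LinearIsometryEquiv.norm_map]

end StationarySequence

/-! ### The unrestricted minimizer -/

/-- The function `1 / (1 + |ℓ|²)`. -/
def resp (ℓ : ℝ → ℂ) (u : ℝ) : ℂ := 1 / (1 + (‖ℓ u‖ : ℂ) ^ 2)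

theorem resp_eq_ofReal (ℓ : ℝ → ℂ) (u : ℝ) : resp ℓ u = ((1 / (1 + ‖ℓ u‖ ^ 2) : ℝ) : ℂ) := by
  simp [resp]

theorem norm_resp_le (ℓ : ℝ → ℂ) (u : ℝ) : ‖resp ℓ u‖ ≤ 1 := by
  rw [resp_eq_ofReal, Complex.norm_real, Real.norm_of_nonneg (by positivity)]
  rw [div_le_one (by positivity)]
  nlinarith [sq_nonneg ‖ℓ u‖]

theorem norm_mul_resp_le (ℓ : ℝ → ℂ) (u : ℝ) : ‖ℓ u * resp ℓ u‖ ≤ 1 := by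
  rw [norm_mul, resp_eq_ofReal, Complex.norm_real, Real.norm_of_nonneg (by positivity),
    mul_one_div, div_le_one (by positivity)]
  nlinarith [sq_nonneg (‖ℓ u‖ - 1)]

theorem resp_ne_zero (ℓ : ℝ → ℂ) (u : ℝ) : resp ℓ u ≠ 0 := by
  rw [resp_eq_ofReal, Complex.ofReal_ne_zero]
  positivity

theorem conj_resp (ℓ : ℝ → ℂ) (u : ℝ) : conj (resp ℓ u) = resp ℓ u := by
  rw [resp_eq_ofReal, Complex.conj_ofReal]

theorem measurable_resp {ℓ : ℝ → ℂ} (hℓ : Measurable ℓ) : Measurable (resp ℓ) := by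
  unfold resp
  fun_prop

theorem memLp_resp {ℓ : ℝ → ℂ} (hℓ : Measurable ℓ) (μ : Measure ℝ) [IsFiniteMeasure μ] :
    MemLp (resp ℓ) 2 μ :=
  MemLp.of_bound (measurable_resp hℓ).aestronglyMeasurable 1 (ae_of_all _ (norm_resp_le ℓ))

def respLp {ℓ : ℝ → ℂ} (hℓ : Measurable ℓ) (μ : Measure ℝ) [IsFiniteMeasure μ] : Lp ℂ 2 μ :=
  (memLp_resp hℓ μ).toLp _

theorem respLp_mem_domain {ℓ : ℝ → ℂ} (hℓ : Measurable ℓ) (μ : Measure ℝ) [IsFiniteMeasure μ] :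
    respLp hℓ μ ∈ (mulOp μ ℓ).domain := by
  change MemLp _ 2 μ
  have h : MemLp (fun u => ℓ u * resp ℓ u) 2 μ :=
    MemLp.of_bound (hℓ.mul (measurable_resp hℓ)).aestronglyMeasurable 1
      (ae_of_all _ (norm_mul_resp_le ℓ))
  refine h.ae_eq ?_
  filter_upwards [(memLp_resp hℓ μ).coeFn_toLp] with u hu
  rw [respLp, hu]

theorem expLp_zero_coeFn (μ : Measure ℝ) [IsFiniteMeasure μ] :
    expLp μ 0 =ᵐ[μ] fun _ => (1 : ℂ) := by
  filter_upwards [(memLp_expI μ 0).coeFn_toLp] with u hu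
  rw [expLp, hu]
  simp

theorem coeFn_mulOp {μ : Measure ℝ} {ℓ : ℝ → ℂ} (φ : (mulOp μ ℓ).domain) :
    mulOp μ ℓ φ =ᵐ[μ] fun u => ℓ u * (φ : Lp ℂ 2 μ) u :=
  MemLp.coeFn_toLp φ.2

/-- The stationarity condition at `η = resp ℓ`: pointwise it is `(η - 1) + |ℓ|² η = 0`. -/
theorem inner_resp_sub {ℓ : ℝ → ℂ} (hℓ : Measurable ℓ) (μ : Measure ℝ) [IsFiniteMeasure μ]
    (ψ : (mulOp μ ℓ).domain) :
    inner ℂ (respLp hℓ μ - expLp μ 0) (ψ : Lp ℂ 2 μ) +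
      inner ℂ (mulOp μ ℓ ⟨_, respLp_mem_domain hℓ μ⟩) (mulOp μ ℓ ψ) = 0 := by
  rw [L2.inner_def, L2.inner_def, ← integral_add (L2.integrable_inner _ _)
    (L2.integrable_inner _ _)]
  refine integral_eq_zero_of_ae ?_
  filter_upwards [coeFn_mulOp ψ, coeFn_mulOp ⟨_, respLp_mem_domain hℓ μ⟩,
    (memLp_resp hℓ μ).coeFn_toLp, expLp_zero_coeFn μ,
    Lp.coeFn_sub (respLp hℓ μ) (expLp μ 0)] with u h1 h2 h3 h4 h5
  rw [h1, h2, h5, Pi.sub_apply, h4, respLp, h3]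
  simp only [RCLike.inner_apply, map_sub, map_mul, conj_resp, map_one, Pi.zero_apply]
  have h6 : ℓ u * conj (ℓ u) = (‖ℓ u‖ : ℂ) ^ 2 := RCLike.mul_conj (ℓ u)
  have h7 : (1 + (‖ℓ u‖ : ℂ) ^ 2) * resp ℓ u = 1 := by
    have : (1 + (‖ℓ u‖ : ℂ) ^ 2) ≠ 0 := by
      exact_mod_cast (by positivity : (1 + ‖ℓ u‖ ^ 2) ≠ 0)
    rw [resp, mul_one_div_cancel this]
  linear_combination (ψ : Lp ℂ 2 μ) u * resp ℓ u * h6 + (ψ : Lp ℂ 2 μ) u * h7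

/-- The value of the unrestricted minimum. -/
def minError {ℓ : ℝ → ℂ} (hℓ : Measurable ℓ) (μ : Measure ℝ) [IsFiniteMeasure μ] : ℝ :=
  ‖respLp hℓ μ - expLp μ 0‖ ^ 2 + ‖mulOp μ ℓ ⟨_, respLp_mem_domain hℓ μ⟩‖ ^ 2

/-- Expanding both squares around `η`, the cross terms cancel by `inner_resp_sub`. -/
theorem error_eq {ℓ : ℝ → ℂ} (hℓ : Measurable ℓ) (μ : Measure ℝ) [IsFiniteMeasure μ]
    (φ : (mulOp μ ℓ).domain) :
    ‖(φ : Lp ℂ 2 μ) - expLp μ 0‖ ^ 2 + ‖mulOp μ ℓ φ‖ ^ 2 =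
      minError hℓ μ + ‖(φ : Lp ℂ 2 μ) - respLp hℓ μ‖ ^ 2 +
        ‖mulOp μ ℓ (φ - ⟨_, respLp_mem_domain hℓ μ⟩)‖ ^ 2 := by
  set η : (mulOp μ ℓ).domain := ⟨_, respLp_mem_domain hℓ μ⟩
  have h := congrArg Complex.re (inner_resp_sub hℓ μ (φ - η))
  have h1 : (φ : Lp ℂ 2 μ) - expLp μ 0 =
      (respLp hℓ μ - expLp μ 0) + ((φ - η : (mulOp μ ℓ).domain) : Lp ℂ 2 μ) := by
    simp [η]
  have h2 : mulOp μ ℓ φ = mulOp μ ℓ η + mulOp μ ℓ (φ - η) := by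
    rw [← LinearPMap.map_add, add_sub_cancel]
  have h3 : (φ : Lp ℂ 2 μ) - respLp hℓ μ = ((φ - η : (mulOp μ ℓ).domain) : Lp ℂ 2 μ) := rfl
  rw [h1, h2, h3, @norm_add_sq ℂ, @norm_add_sq ℂ, minError]
  rw [Complex.add_re, Complex.zero_re] at h
  simp only [RCLike.re_to_complex]
  linarith

namespace StationarySequence

variable {Ω : Type*} [MeasurableSpace Ω] {P : Measure Ω}

theorem predictionError_nonempty {μ : Measure ℝ} [IsFiniteMeasure μ] (ℓ : ℝ → ℂ) (T : Set ℤ) :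
    {r : ℝ | ∃ φ : (mulOp μ ℓ).domain, (φ : Lp ℂ 2 μ) ∈ expSpan μ T ∧
      r = ‖(φ : Lp ℂ 2 μ) - expLp μ 0‖ ^ 2 + ‖mulOp μ ℓ φ‖ ^ 2}.Nonempty :=
  ⟨_, 0, Submodule.zero_mem _, rfl⟩

theorem minError_le_predictionError (B : StationarySequence P) {μ : Measure ℝ}
    [IsFiniteMeasure μ] (h : B.IsSpectralMeasure μ) {ℓ : ℝ → ℂ} (hℓ : Measurable ℓ) (T : Set ℤ) :
    minError hℓ μ ≤ B.predictionError h ℓ T := by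
  rw [B.predictionError_eq]
  refine le_csInf (predictionError_nonempty ℓ T) ?_
  rintro _ ⟨φ, -, rfl⟩
  rw [error_eq hℓ]
  nlinarith [sq_nonneg ‖(φ : Lp ℂ 2 μ) - respLp hℓ μ‖,
    sq_nonneg ‖mulOp μ ℓ (φ - ⟨_, respLp_mem_domain hℓ μ⟩)‖]

/-- The restricted minimum equals the unrestricted one iff the unrestricted minimizer satisfies
the restriction. -/
theorem predictionError_eq_minError_iff (B : StationarySequence P) {μ : Measure ℝ}
    [IsFiniteMeasure μ] (h : B.IsSpectralMeasure μ) {ℓ : ℝ → ℂ} (hℓ : Measurable ℓ) (T : Set ℤ) :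
    B.predictionError h ℓ T = minError hℓ μ ↔ respLp hℓ μ ∈ expSpan μ T := by
  constructor
  · intro he
    rw [B.predictionError_eq] at he
    rw [← SetLike.mem_coe, ← (isClosed_expSpan μ T).closure_eq, Metric.mem_closure_iff]
    intro ε hε
    -- An admissible `φ` within `ε²` of the minimum is within `ε` of `η`, by the excess term in
    -- `error_eq`.
    obtain ⟨_, ⟨φ, hφ, rfl⟩, hr⟩ := exists_lt_of_csInf_lt (predictionError_nonempty ℓ T)
      (he.trans_lt (lt_add_of_pos_right _ (by positivity : 0 < ε ^ 2)))
    refine ⟨φ, hφ, ?_⟩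
    rw [error_eq hℓ] at hr
    rw [dist_comm, dist_eq_norm]
    refine lt_of_pow_lt_pow_left₀ 2 hε.le ?_
    nlinarith [sq_nonneg ‖mulOp μ ℓ (φ - ⟨_, respLp_mem_domain hℓ μ⟩)‖]
  · intro hm
    refine le_antisymm ?_ (B.minError_le_predictionError h hℓ T)
    rw [B.predictionError_eq]
    refine csInf_le ⟨0, ?_⟩ ⟨⟨_, respLp_mem_domain hℓ μ⟩, hm, rfl⟩
    rintro _ ⟨φ, -, rfl⟩
    positivity

theorem predictionError_univ (B : StationarySequence P) {μ : Measure ℝ}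
    [IsFiniteMeasure μ] (h : B.IsSpectralMeasure μ) {ℓ : ℝ → ℂ} (hℓ : Measurable ℓ) :
    B.predictionError h ℓ univ = minError hℓ μ := by
  rw [B.predictionError_eq_minError_iff h hℓ, expSpan_univ μ h.carried]
  trivial

end StationarySequence

/-! ### Multiplication by exponentials -/

theorem norm_expI (t : ℤ) (u : ℝ) : ‖Complex.exp (Complex.I * t * u)‖ = 1 := by
  have : Complex.I * t * u = ((t * u : ℝ) : ℂ) * Complex.I := by push_cast; ring
  rw [this, Complex.norm_exp_ofReal_mul_I]

theorem expI_mul (s t : ℤ) (u : ℝ) : Complex.exp (Complex.I * s * u) *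
    Complex.exp (Complex.I * t * u) = Complex.exp (Complex.I * (s + t : ℤ) * u) := by
  rw [← Complex.exp_add]
  congr 1
  push_cast
  ring

theorem conj_expI (t : ℤ) (u : ℝ) : conj (Complex.exp (Complex.I * t * u)) =
    Complex.exp (Complex.I * (-t : ℤ) * u) := by
  rw [← Complex.exp_conj]
  congr 1
  simp

theorem coeFn_expLp (μ : Measure ℝ) [IsFiniteMeasure μ] (t : ℤ) :
    expLp μ t =ᵐ[μ] fun u : ℝ => Complex.exp (Complex.I * t * u) :=
  (memLp_expI μ t).coeFn_toLp

theorem coeFn_sum_smul_expLp (μ : Measure ℝ) [IsFiniteMeasure μ] (b : ℤ → ℂ) (s : Finset ℤ) :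
    (∑ j ∈ s, b j • expLp μ j : Lp ℂ 2 μ) =ᵐ[μ]
      fun u => ∑ j ∈ s, b j * Complex.exp (Complex.I * j * u) := by
  induction s using Finset.induction_on with
  | empty =>
    simp only [Finset.sum_empty]
    exact Lp.coeFn_zero ℂ 2 μ
  | insert j s hj ih =>
    simp only [Finset.sum_insert hj]
    filter_upwards [Lp.coeFn_add (b j • expLp μ j) (∑ j ∈ s, b j • expLp μ j),
      Lp.coeFn_smul (b j) (expLp μ j), ih, coeFn_expLp μ j] with u a1 a2 a3 a4
    rw [a1, Pi.add_apply, a2, a3, Pi.smul_apply, a4, smul_eq_mul]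

theorem memLp_mul_of_norm_le_one {μ : Measure ℝ} {k φ : ℝ → ℂ} (hk : AEStronglyMeasurable k μ)
    (hk1 : ∀ u, ‖k u‖ ≤ 1) (hφ : MemLp φ 2 μ) : MemLp (fun u => k u * φ u) 2 μ := by
  refine hφ.mono (hk.mul hφ.aestronglyMeasurable) (ae_of_all _ fun u => ?_)
  rw [norm_mul]
  exact mul_le_of_le_one_left (norm_nonneg _) (hk1 u)

theorem memLp_expI_mul {μ : Measure ℝ} (s : ℤ) {φ : ℝ → ℂ} (hφ : MemLp φ 2 μ) :
    MemLp (fun u : ℝ => Complex.exp (Complex.I * s * u) * φ u) 2 μ :=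
  memLp_mul_of_norm_le_one (by fun_prop : Continuous _).aestronglyMeasurable
    (fun u => (norm_expI s u).le) hφ

/-- Multiplication by `e^{isu}` on `L²(μ)`. -/
def expMul (μ : Measure ℝ) (s : ℤ) : Lp ℂ 2 μ →ₗᵢ[ℂ] Lp ℂ 2 μ where
  toFun φ := (memLp_expI_mul s (Lp.memLp φ)).toLp _
  map_add' φ ψ := by
    rw [← MemLp.toLp_add]
    refine MemLp.toLp_congr _ _ ?_
    filter_upwards [Lp.coeFn_add φ ψ] with u hu
    rw [hu, Pi.add_apply, Pi.add_apply, mul_add]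
  map_smul' c φ := by
    rw [RingHom.id_apply, ← MemLp.toLp_const_smul]
    refine MemLp.toLp_congr _ _ ?_
    filter_upwards [Lp.coeFn_smul c φ] with u hu
    rw [hu, Pi.smul_apply, Pi.smul_apply, smul_eq_mul, smul_eq_mul, mul_left_comm]
  norm_map' φ := by
    change ‖(memLp_expI_mul s (Lp.memLp φ)).toLp _‖ = ‖φ‖
    rw [Lp.norm_toLp, Lp.norm_def]
    congr 1
    refine eLpNorm_congr_norm_ae (ae_of_all _ fun u => ?_)
    rw [norm_mul, norm_expI, one_mul]

theorem coeFn_expMul {μ : Measure ℝ} (s : ℤ) (φ : Lp ℂ 2 μ) :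
    expMul μ s φ =ᵐ[μ] fun u : ℝ => Complex.exp (Complex.I * s * u) * φ u :=
  (memLp_expI_mul s (Lp.memLp φ)).coeFn_toLp

theorem expMul_expLp (μ : Measure ℝ) [IsFiniteMeasure μ] (s t : ℤ) :
    expMul μ s (expLp μ t) = expLp μ (s + t) := by
  apply Lp.ext
  filter_upwards [coeFn_expMul s (expLp μ t), coeFn_expLp μ t, coeFn_expLp μ (s + t)]
    with u h1 h2 h3
  rw [h1, h2, h3, expI_mul]

theorem expMul_neg_cancel {μ : Measure ℝ} (s : ℤ) (φ : Lp ℂ 2 μ) :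
    expMul μ s (expMul μ (-s) φ) = φ := by
  apply Lp.ext
  filter_upwards [coeFn_expMul s (expMul μ (-s) φ), coeFn_expMul (-s) φ] with u h1 h2
  rw [h1, h2, ← mul_assoc, expI_mul]
  simp

theorem expMul_mem_expSpan {μ : Measure ℝ} [IsFiniteMeasure μ] {S T : Set ℤ} {s : ℤ}
    (h : ∀ t ∈ S, s + t ∈ T) {φ : Lp ℂ 2 μ} (hφ : φ ∈ expSpan μ S) :
    expMul μ s φ ∈ expSpan μ T := by
  have : expSpan μ S ≤ (expSpan μ T).comap (expMul μ s).toLinearMap := by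
    refine expSpan_le ((isClosed_expSpan μ T).preimage (expMul μ s).continuous) fun t ht => ?_
    change expMul μ s (expLp μ t) ∈ expSpan μ T
    rw [expMul_expLp]
    exact expLp_mem_expSpan μ (h t ht)
  exact this hφ

/-! ### The innovation -/

/-- The part of the constant function `1` orthogonal to the strict past. -/
def innov (μ : Measure ℝ) [IsFiniteMeasure μ] : Lp ℂ 2 μ :=
  expLp μ 0 - (expSpan μ (Iic (-1))).starProjection (expLp μ 0)

theorem expLp_sub_innov_mem (μ : Measure ℝ) [IsFiniteMeasure μ] :
    expLp μ 0 - innov μ ∈ expSpan μ (Iic (-1)) := by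
  rw [innov, sub_sub_cancel]
  exact Submodule.starProjection_apply_mem _ _

theorem innov_mem (μ : Measure ℝ) [IsFiniteMeasure μ] : innov μ ∈ expSpan μ (Iic 0) := by
  have h := expSpan_mono μ (Iic_subset_Iic.2 (by norm_num : (-1 : ℤ) ≤ 0)) (expLp_sub_innov_mem μ)
  have := (expSpan μ (Iic 0)).sub_mem (expLp_mem_expSpan μ (mem_Iic.2 (le_refl 0))) h
  rwa [sub_sub_cancel] at this

theorem inner_innov {μ : Measure ℝ} [IsFiniteMeasure μ] {φ : Lp ℂ 2 μ}
    (hφ : φ ∈ expSpan μ (Iic (-1))) : inner ℂ (innov μ) φ = 0 :=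
  (Submodule.mem_orthogonal' _ _).1 (Submodule.sub_starProjection_mem_orthogonal _) φ hφ

/-- Multiplication by `e^{inu}` is unitary and carries the strict past of time `0` to that of time
`n`. -/
theorem inner_expMul_innov {μ : Measure ℝ} [IsFiniteMeasure μ] {n : ℤ} {φ : Lp ℂ 2 μ}
    (hφ : φ ∈ expSpan μ (Iic (n - 1))) : inner ℂ (expMul μ n (innov μ)) φ = 0 := by
  rw [← expMul_neg_cancel n φ, LinearIsometry.inner_map_map]
  refine inner_innov (expMul_mem_expSpan (fun t ht => ?_) hφ)
  simp only [mem_Iic] at ht ⊢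
  omega

/-- Of two distinct shifts of the innovation, the earlier one lies in the strict past to which the
later one is orthogonal. -/
theorem inner_innov_expMul {μ : Measure ℝ} [IsFiniteMeasure μ] {s : ℤ} (hs : s ≠ 0) :
    inner ℂ (innov μ) (expMul μ s (innov μ)) = 0 := by
  rcases lt_or_gt_of_ne hs with h | h
  · refine inner_innov (expMul_mem_expSpan (fun t ht => ?_) (innov_mem μ))
    simp only [mem_Iic] at ht ⊢
    omega
  · rw [inner_eq_zero_symm]
    exact inner_expMul_innov
      (expSpan_mono μ (Iic_subset_Iic.2 (by omega : (0 : ℤ) ≤ s - 1)) (innov_mem μ))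

theorem innov_inner_one (μ : Measure ℝ) [IsFiniteMeasure μ] :
    inner ℂ (innov μ) (expLp μ 0) = (‖innov μ‖ : ℂ) ^ 2 := by
  have h := inner_innov (expLp_sub_innov_mem μ)
  rw [inner_sub_right, sub_eq_zero] at h
  rw [h, inner_self_eq_norm_sq_to_K]
  rfl

/-- If the innovation vanishes, the past determines everything. -/
theorem expSpan_Iic_eq_top {μ : Measure ℝ} [IsFiniteMeasure μ] (hμ : μ (Ico (-π) π)ᶜ = 0)
    (h0 : innov μ = 0) (t : ℤ) : expSpan μ (Iic t) = ⊤ := by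
  have h1 : expLp μ 0 ∈ expSpan μ (Iic (-1)) := by
    simpa only [h0, sub_zero] using expLp_sub_innov_mem μ
  have h2 : ∀ s, expLp μ s ∈ expSpan μ (Iic (s - 1)) := by
    intro s
    have := expMul_mem_expSpan (s := s) (T := Iic (s - 1))
      (fun t ht => by simp only [mem_Iic] at ht ⊢; omega) h1
    rwa [expMul_expLp, add_zero] at this
  -- Each `e^{isu}` is already in the span of the earlier ones, so advancing the half-line one step
  -- at a time adds nothing.
  have h3 : ∀ n : ℕ, expSpan μ (Iic (t + n)) ≤ expSpan μ (Iic t) := by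
    intro n
    induction n with
    | zero => simp
    | succ n ih =>
      refine le_trans (expSpan_le (isClosed_expSpan μ _) fun s hs => ?_) ih
      rcases (mem_Iic.1 hs).eq_or_lt with he | hl
      · have := h2 s
        rwa [show s - 1 = t + n by push_cast at he; omega] at this
      · exact expLp_mem_expSpan μ (by simp only [mem_Iic]; push_cast at hl; omega)
  rw [eq_top_iff, ← expSpan_univ μ hμ]
  refine expSpan_le (isClosed_expSpan μ _) fun s _ => ?_
  refine h3 (s - t).toNat (expLp_mem_expSpan μ ?_)
  simp only [mem_Iic]
  omega

/-! ### The spectral measure of the innovation -/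

/-- A finite measure on `[-π, π)` is determined by its Fourier coefficients. -/
theorem measure_ext_of_integral_expI {ν₁ ν₂ : Measure ℝ} [IsFiniteMeasure ν₁] [IsFiniteMeasure ν₂]
    (h1 : ν₁ (Ico (-π) π)ᶜ = 0) (h2 : ν₂ (Ico (-π) π)ᶜ = 0)
    (h : ∀ s : ℤ, ∫ u : ℝ, Complex.exp (Complex.I * s * u) ∂ν₁ =
      ∫ u : ℝ, Complex.exp (Complex.I * s * u) ∂ν₂) : ν₁ = ν₂ := by
  set ρ := ν₁ + ν₂
  have hρ : ρ (Ico (-π) π)ᶜ = 0 := by simp [ρ, h1, h2]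
  have l1 : ν₁ ≤ ρ := Measure.le_add_right le_rfl
  have l2 : ν₂ ≤ ρ := Measure.le_add_left le_rfl
  -- Dominated by the sum `ρ`, each measure has a density at most `1`, hence in `L²(ρ)`, where the
  -- exponentials are total.
  have key : ∀ ν : Measure ℝ, IsFiniteMeasure ν → ν ≤ ρ → ∃ D : Lp ℂ 2 ρ,
      (D =ᵐ[ρ] fun u => (((ν.rnDeriv ρ u).toReal : ℝ) : ℂ)) ∧
      ∀ s : ℤ, inner ℂ D (expLp ρ s) = ∫ u : ℝ, Complex.exp (Complex.I * s * u) ∂ν := by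
    intro ν _ hν
    have hb := Measure.rnDeriv_le_one_of_le hν
    have hm : MemLp (fun u => (((ν.rnDeriv ρ u).toReal : ℝ) : ℂ)) 2 ρ := by
      refine MemLp.of_bound (Complex.measurable_ofReal.comp
        (Measure.measurable_rnDeriv ν ρ).ennreal_toReal).aestronglyMeasurable 1 ?_
      filter_upwards [hb] with u hu
      rw [Complex.norm_real, Real.norm_of_nonneg ENNReal.toReal_nonneg]
      exact ENNReal.toReal_le_of_le_ofReal zero_le_one (by simpa using hu)
    refine ⟨hm.toLp _, hm.coeFn_toLp, fun s => ?_⟩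
    rw [L2.inner_def, ← integral_rnDeriv_smul (Measure.absolutelyContinuous_of_le hν)]
    refine integral_congr_ae ?_
    filter_upwards [hm.coeFn_toLp, coeFn_expLp ρ s] with u h3 h4
    rw [h3, h4, RCLike.inner_apply, Complex.conj_ofReal, Complex.real_smul, mul_comm]
  obtain ⟨D1, hD1, hi1⟩ := key ν₁ inferInstance l1
  obtain ⟨D2, hD2, hi2⟩ := key ν₂ inferInstance l2
  have h0 : D1 - D2 = 0 := eq_zero_of_forall_inner_expLp hρ fun s => by
    rw [inner_sub_left, hi1, hi2, h s, sub_self]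
  rw [sub_eq_zero] at h0
  rw [← Measure.withDensity_rnDeriv_eq _ _ (Measure.absolutelyContinuous_of_le l1),
    ← Measure.withDensity_rnDeriv_eq ν₂ _ (Measure.absolutelyContinuous_of_le l2)]
  refine withDensity_congr_ae ?_
  rw [h0] at hD1
  filter_upwards [hD1, hD2, Measure.rnDeriv_lt_top ν₁ ρ, Measure.rnDeriv_lt_top ν₂ ρ]
    with u a1 a2 b1 b2
  rw [a1, Complex.ofReal_inj, ENNReal.toReal_eq_toReal_iff' b1.ne b2.ne] at a2
  exact a2

/-- Lebesgue measure on `[-π, π)`. -/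
abbrev lebIco : Measure ℝ := volume.restrict (Ico (-π) π)

theorem lebIco_compl : lebIco (Ico (-π) π)ᶜ = 0 := by
  rw [Measure.restrict_apply measurableSet_Ico.compl, compl_inter_self, measure_empty]

theorem integral_expI_lebIco (s : ℤ) : ∫ u : ℝ, Complex.exp (Complex.I * s * u) ∂lebIco =
    if s = 0 then 2 * (π : ℂ) else 0 := by
  rw [integral_Ico_eq_integral_Ioo, ← integral_Ioc_eq_integral_Ioo,
    ← intervalIntegral.integral_of_le (by linarith [Real.pi_pos])]
  split_ifs with h
  · subst h
    simp
    ring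
  · have hc : Complex.I * s ≠ 0 := mul_ne_zero Complex.I_ne_zero (by exact_mod_cast h)
    rw [integral_exp_mul_complex hc]
    have : Complex.exp (Complex.I * s * (π : ℝ)) = Complex.exp (Complex.I * s * (-π : ℝ)) := by
      rw [Complex.exp_eq_exp_iff_exists_int]
      exact ⟨s, by push_cast; ring⟩
    rw [this, sub_self, zero_div]

/-- `|g|² dμ` for an element `g` of `L²(μ)`. -/
def sqMeasure {μ : Measure ℝ} (g : Lp ℂ 2 μ) : Measure ℝ := μ.withDensity fun u => ‖g u‖ₑ ^ 2

theorem measurable_enorm_sq {μ : Measure ℝ} (g : Lp ℂ 2 μ) :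
    Measurable fun u => ‖g u‖ₑ ^ 2 :=
  (Lp.stronglyMeasurable g).measurable.enorm.pow_const 2

instance isFiniteMeasure_sqMeasure {μ : Measure ℝ} (g : Lp ℂ 2 μ) :
    IsFiniteMeasure (sqMeasure g) := by
  refine isFiniteMeasure_withDensity ?_
  have h := lintegral_rpow_enorm_lt_top_of_eLpNorm_lt_top (by norm_num) (by norm_num)
    (Lp.memLp g).eLpNorm_lt_top
  simpa using h.ne

theorem integral_sqMeasure {μ : Measure ℝ} (g : Lp ℂ 2 μ) (k : ℝ → ℂ) :
    ∫ u, k u ∂sqMeasure g = ∫ u, k u * g u * conj (g u) ∂μ := by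
  rw [sqMeasure, integral_withDensity_eq_integral_toReal_smul (measurable_enorm_sq g)
    (ae_of_all _ fun u => by simp)]
  refine integral_congr_ae (ae_of_all _ fun u => ?_)
  have h : g u * conj (g u) = (‖g u‖ : ℂ) ^ 2 := RCLike.mul_conj (g u)
  simp only
  rw [mul_assoc, h, Complex.real_smul, ENNReal.toReal_pow, toReal_enorm]
  push_cast
  ring

/-- The Fourier coefficients of `|g|² dμ` are the inner products of `g` with `e^{isu} g`; only the
one with `s = 0` survives. The constant matches total masses. -/
theorem sqMeasure_innov {μ : Measure ℝ} [IsFiniteMeasure μ] (hμ : μ (Ico (-π) π)ᶜ = 0) :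
    sqMeasure (innov μ) = ENNReal.ofReal (‖innov μ‖ ^ 2 / (2 * π)) • lebIco := by
  have hfin : IsFiniteMeasure (ENNReal.ofReal (‖innov μ‖ ^ 2 / (2 * π)) • lebIco) :=
    Measure.smul_finite _ ENNReal.ofReal_ne_top
  refine measure_ext_of_integral_expI (withDensity_absolutelyContinuous _ _ hμ) ?_ fun s => ?_
  · rw [Measure.smul_apply, lebIco_compl, smul_zero]
  have h1 : ∫ u : ℝ, Complex.exp (Complex.I * s * u) ∂sqMeasure (innov μ) =
      inner ℂ (innov μ) (expMul μ s (innov μ)) := by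
    rw [integral_sqMeasure, L2.inner_def]
    refine integral_congr_ae ?_
    filter_upwards [coeFn_expMul s (innov μ)] with u hu
    rw [hu, RCLike.inner_apply]
  rw [h1, integral_smul_measure, integral_expI_lebIco, ENNReal.toReal_ofReal (by positivity)]
  split_ifs with h
  · subst h
    have h2 : expMul μ 0 (innov μ) = innov μ := by
      apply Lp.ext
      filter_upwards [coeFn_expMul 0 (innov μ)] with u hu
      rw [hu]
      simp
    rw [h2, inner_self_eq_norm_sq_to_K, Complex.real_smul]
    have : (π : ℂ) ≠ 0 := by exact_mod_cast Real.pi_ne_zero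
    push_cast
    field_simp
    rfl
  · rw [inner_innov_expMul h, smul_zero]

theorem lebIco_absolutelyContinuous {μ : Measure ℝ} [IsFiniteMeasure μ]
    (hμ : μ (Ico (-π) π)ᶜ = 0) (h0 : innov μ ≠ 0) : lebIco ≪ μ := by
  have h1 : ENNReal.ofReal (‖innov μ‖ ^ 2 / (2 * π)) ≠ 0 := by
    have := norm_pos_iff.2 h0
    have := Real.pi_pos
    rw [Ne, ENNReal.ofReal_eq_zero, not_le]
    positivity
  refine (Measure.absolutelyContinuous_smul h1).trans ?_
  rw [← sqMeasure_innov hμ]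
  exact withDensity_absolutelyContinuous _ _

/-! ### The remote past contains the singular part -/

/-- Elements of `L²(μ)` that are zero Lebesgue-almost everywhere belong to the closed span of each
half-line. -/
theorem mem_expSpan_of_ae_eq_zero {μ : Measure ℝ} [IsFiniteMeasure μ]
    (hμ : μ (Ico (-π) π)ᶜ = 0) {φ : Lp ℂ 2 μ} (hφ : ∀ᵐ u ∂lebIco, φ u = 0) (t : ℤ) :
    φ ∈ expSpan μ (Iic t) := by
  -- Since `|g|² dμ` is a multiple of Lebesgue measure, `φ g = 0` holds `μ`-a.e.; hence `φ` is
  -- orthogonal to every `e^{inu} g`.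
  have h1 : ∀ᵐ u ∂μ, innov μ u ≠ 0 → φ u = 0 := by
    have h2 : ∀ᵐ u ∂sqMeasure (innov μ), φ u = 0 := by
      rw [sqMeasure_innov hμ]
      exact Measure.ae_smul_measure hφ _
    rw [sqMeasure, ae_withDensity_iff (measurable_enorm_sq _)] at h2
    filter_upwards [h2] with u hu h3
    exact hu (by simpa using h3)
  have h2 : ∀ n, inner ℂ (expMul μ n (innov μ)) φ = 0 := by
    intro n
    rw [L2.inner_def]
    refine integral_eq_zero_of_ae ?_
    filter_upwards [h1, coeFn_expMul n (innov μ)] with u hu hn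
    rw [hn, RCLike.inner_apply, Pi.zero_apply]
    by_cases h3 : innov μ u = 0
    · simp [h3]
    · simp [hu h3]
  set K := expSpan μ (Iic t)
  set r := φ - K.starProjection φ
  -- Induction on time: `e^{isu} = e^{isu} g + e^{isu}(1 - g)`. The residual is orthogonal to the
  -- first summand, as `φ` and its projection are, and to the second, which belongs to the previous
  -- span.
  have hr : ∀ n : ℕ, ∀ ψ ∈ expSpan μ (Iic (t + n)), inner ℂ r ψ = 0 := by
    intro n
    induction n with
    | zero =>
      intro ψ hψ
      rw [Nat.cast_zero, add_zero] at hψ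
      exact (Submodule.mem_orthogonal' _ _).1 (Submodule.sub_starProjection_mem_orthogonal _) ψ hψ
    | succ n ih =>
      intro ψ hψ
      refine inner_eq_zero_of_mem_expSpan (fun s hs => ?_) hψ
      rcases (mem_Iic.1 hs).eq_or_lt with he | hl
      · have hs1 : s - 1 = t + n := by push_cast at he; omega
        have h4 : inner ℂ r (expMul μ s (innov μ)) = 0 := by
          rw [inner_sub_left, inner_eq_zero_symm.1 (h2 s), zero_sub, neg_eq_zero,
            inner_eq_zero_symm]
          refine inner_expMul_innov (expSpan_mono μ (Iic_subset_Iic.2 ?_)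
            (Submodule.starProjection_apply_mem _ _))
          omega
        have h5 : expMul μ s (expLp μ 0 - innov μ) ∈ expSpan μ (Iic (t + n)) :=
          expMul_mem_expSpan (fun k hk => by simp only [mem_Iic] at hk ⊢; omega)
            (expLp_sub_innov_mem μ)
        have h6 := ih _ h5
        rw [map_sub, inner_sub_right, h4, sub_zero, expMul_expLp, add_zero] at h6
        exact h6
      · exact ih _ (expLp_mem_expSpan μ (by simp only [mem_Iic]; push_cast at hl; omega))
  have hr0 : r = 0 := eq_zero_of_forall_inner_expLp hμ fun s =>
    hr (s - t).toNat _ (expLp_mem_expSpan μ (by simp only [mem_Iic]; omega))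
  rw [sub_eq_zero] at hr0
  rw [hr0]
  exact Submodule.starProjection_apply_mem _ _

/-! ### Bounded elements of the closed span of a half-line -/

/-- If the innovation does not vanish, a bounded element of the closed span of `e^{isu}`, `s ≤ t`,
in `L²(μ)` has no Fourier coefficients of index exceeding `t`. -/
theorem fourier_eq_zero_of_mem_expSpan {μ : Measure ℝ} [IsFiniteMeasure μ]
    (hμ : μ (Ico (-π) π)ᶜ = 0) (h0 : innov μ ≠ 0) {h : ℝ → ℂ} (hm : MemLp h 2 μ)
    (hmeas : Measurable h) (hb : ∀ u, ‖h u‖ ≤ 1) {t : ℤ} (ht : hm.toLp h ∈ expSpan μ (Iic t))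
    {n : ℤ} (hn : t < n) :
    ∫ u : ℝ, Complex.exp (Complex.I * (-n : ℤ) * u) * h u ∂lebIco = 0 := by
  -- Boundedness of `h` keeps `k = conj h · e^{inu} g` in `L²(μ)`. For `s ≤ 0` its product with
  -- `e^{isu}` is that of `e^{i(n-s)u} g` with `h`, zero because `n - s > t`. So `k` is orthogonal
  -- to `g`, which says `∫ e^{-inu} h |g|² dμ = 0`.
  have hk : MemLp (fun u => conj (h u) * expMul μ n (innov μ) u) 2 μ :=
    memLp_mul_of_norm_le_one (by fun_prop) (fun u => by rw [RCLike.norm_conj]; exact hb u)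
      (Lp.memLp _)
  have h1 : ∀ s ∈ Iic (0 : ℤ), inner ℂ (hk.toLp _) (expLp μ s) = 0 := by
    intro s hs
    have h2 : inner ℂ (hk.toLp _) (expLp μ s) =
        inner ℂ (expMul μ (n - s) (innov μ)) (hm.toLp h) := by
      rw [L2.inner_def, L2.inner_def]
      refine integral_congr_ae ?_
      filter_upwards [hk.coeFn_toLp, coeFn_expLp μ s, coeFn_expMul (n - s) (innov μ),
        hm.coeFn_toLp, coeFn_expMul n (innov μ)] with u a1 a2 a3 a4 a5
      rw [a1, a2, a3, a4, a5]
      simp only [RCLike.inner_apply, map_mul, conj_expI, RCLike.conj_conj]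
      rw [show -(n - s) = s + -n by ring, ← expI_mul]
      ring
    rw [h2]
    refine inner_expMul_innov (expSpan_mono μ (Iic_subset_Iic.2 ?_) ht)
    rw [mem_Iic] at hs
    omega
  have h2 := inner_eq_zero_of_mem_expSpan h1 (innov_mem μ)
  have h3 : inner ℂ (hk.toLp _) (innov μ) =
      ∫ u : ℝ, Complex.exp (Complex.I * (-n : ℤ) * u) * h u ∂sqMeasure (innov μ) := by
    rw [integral_sqMeasure, L2.inner_def]
    refine integral_congr_ae ?_
    filter_upwards [hk.coeFn_toLp, coeFn_expMul n (innov μ)] with u a1 a5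
    rw [a1, a5]
    simp only [RCLike.inner_apply, map_mul, conj_expI, RCLike.conj_conj]
    ring
  rw [h3, sqMeasure_innov hμ, integral_smul_measure, smul_eq_zero] at h2
  refine h2.resolve_left ?_
  rw [ENNReal.toReal_ofReal (by positivity)]
  have := norm_pos_iff.2 h0
  have := Real.pi_pos
  positivity

/-- A bounded real function without Fourier coefficients of index exceeding `t` is a
trigonometric polynomial of degree at most `t`. -/
theorem isAETrigPoly_of_fourier_eq_zero {h : ℝ → ℂ} (hm : MemLp h 2 lebIco)
    (hreal : ∀ u, conj (h u) = h u) {t : ℤ}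
    (hz : ∀ n, t < n → ∫ u : ℝ, Complex.exp (Complex.I * (-n : ℤ) * u) * h u ∂lebIco = 0) :
    IsAETrigPoly h t := by
  have hπ : (2 * π : ℂ) ≠ 0 := by exact_mod_cast Real.two_pi_pos.ne'
  -- For real `h`, conjugation exchanges the coefficients of index `n` and `-n`.
  have hz' : ∀ n, n < -t → ∫ u : ℝ, Complex.exp (Complex.I * (-n : ℤ) * u) * h u ∂lebIco = 0 := by
    intro n hn
    have h1 := congrArg conj (hz (-n) (by omega))
    rw [map_zero, ← integral_conj] at h1
    rw [← h1]
    refine integral_congr_ae (ae_of_all _ fun u => ?_)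
    simp only [map_mul, conj_expI, hreal, neg_neg]
  have hi : ∀ n m : ℤ, inner ℂ (expLp lebIco n) (expLp lebIco m) =
      if n = m then (2 * π : ℂ) else 0 := by
    intro n m
    have h1 := integral_expI_lebIco (m - n)
    simp only [sub_eq_zero, eq_comm (a := m)] at h1
    rw [← h1, L2.inner_def]
    refine integral_congr_ae ?_
    filter_upwards [coeFn_expLp lebIco n, coeFn_expLp lebIco m] with u h2 h3
    rw [h2, h3, RCLike.inner_apply, conj_expI, expI_mul]
    rfl
  have hc : ∀ n : ℤ, inner ℂ (expLp lebIco n) (hm.toLp h) =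
      ∫ u : ℝ, Complex.exp (Complex.I * (-n : ℤ) * u) * h u ∂lebIco := by
    intro n
    rw [L2.inner_def]
    refine integral_congr_ae ?_
    filter_upwards [coeFn_expLp lebIco n, hm.coeFn_toLp] with u h2 h3
    rw [h2, h3, RCLike.inner_apply, conj_expI, mul_comm]
  let b : ℤ → ℂ := fun j => inner ℂ (expLp lebIco j) (hm.toLp h) / (2 * π)
  have h0 : hm.toLp h - ∑ j ∈ Finset.Icc (-t) t, b j • expLp lebIco j = 0 := by
    refine eq_zero_of_forall_inner_expLp lebIco_compl fun n => ?_
    rw [inner_eq_zero_symm, inner_sub_right, inner_sum]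
    simp only [inner_smul_right, hi, mul_ite, mul_zero, Finset.sum_ite_eq]
    split_ifs with hn
    · rw [div_mul_cancel₀ _ hπ, sub_self]
    · rw [sub_zero, hc]
      rw [Finset.mem_Icc, not_and_or, not_le, not_le] at hn
      exact hn.elim (hz' n) (hz n)
  rw [sub_eq_zero] at h0
  refine ⟨b, ?_⟩
  filter_upwards [hm.coeFn_toLp, coeFn_sum_smul_expLp lebIco b (Finset.Icc (-t) t)] with u a1 a2
  rw [← a1, h0, a2]

/-! ### Polynomials in `e^{-iu}` -/

/-- Evaluating at `z = e^{-iu}` turns the past exponentials into nonnegative powers, so the past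
consists of ordinary polynomials in `z`. -/
theorem circleMap_neg_pow (k : ℕ) (u : ℝ) :
    circleMap 0 1 (-u) ^ k = Complex.exp (Complex.I * (-k : ℤ) * u) := by
  rw [circleMap, zero_add, Complex.ofReal_one, one_mul, ← Complex.exp_nat_mul]
  congr 1
  push_cast
  ring

theorem continuous_eval_circleMap_neg (p : Polynomial ℂ) :
    Continuous fun u : ℝ => p.eval (circleMap 0 1 (-u)) :=
  p.continuous.comp ((continuous_circleMap 0 1).comp continuous_neg)

theorem norm_eval_circleMap_neg_le (p : Polynomial ℂ) (u : ℝ) :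
    ‖p.eval (circleMap 0 1 (-u))‖ ≤ ∑ k ∈ Finset.range (p.natDegree + 1), ‖p.coeff k‖ := by
  rw [Polynomial.eval_eq_sum_range]
  refine (norm_sum_le _ _).trans (Finset.sum_le_sum fun k _ => ?_)
  rw [circleMap_neg_pow, norm_mul, norm_expI, mul_one]

/-- Elements of the span of `e^{isu}`, `s ≤ 0`, are polynomials in `e^{-iu}`. -/
theorem exists_polynomial_of_mem_span {μ : Measure ℝ} [IsFiniteMeasure μ] {y : Lp ℂ 2 μ}
    (hy : y ∈ Submodule.span ℂ (expLp μ '' Iic 0)) :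
    ∃ p : Polynomial ℂ, y =ᵐ[μ] fun u => p.eval (circleMap 0 1 (-u)) := by
  induction hy using Submodule.span_induction with
  | mem x hx =>
    obtain ⟨s, hs, rfl⟩ := hx
    refine ⟨Polynomial.X ^ (-s).toNat, ?_⟩
    filter_upwards [coeFn_expLp μ s] with u hu
    rw [hu, Polynomial.eval_pow, Polynomial.eval_X, circleMap_neg_pow,
      Int.toNat_of_nonneg (by have := mem_Iic.1 hs; omega), neg_neg]
  | zero =>
    refine ⟨0, ?_⟩
    filter_upwards [Lp.coeFn_zero ℂ 2 μ] with u hu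
    rw [hu, Polynomial.eval_zero, Pi.zero_apply]
  | add x y _ _ hx hy =>
    obtain ⟨p, hp⟩ := hx
    obtain ⟨q, hq⟩ := hy
    refine ⟨p + q, ?_⟩
    filter_upwards [Lp.coeFn_add x y, hp, hq] with u h1 h2 h3
    rw [h1, Pi.add_apply, h2, h3, Polynomial.eval_add]
  | smul c x _ hx =>
    obtain ⟨p, hp⟩ := hx
    refine ⟨Polynomial.C c * p, ?_⟩
    filter_upwards [Lp.coeFn_smul c x, hp] with u h1 h2
    rw [h1, Pi.smul_apply, h2, Polynomial.eval_mul, Polynomial.eval_C, smul_eq_mul]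

/-- An element of the strict past is `z q(z)`; subtracting it from `1` leaves the constant
coefficient `1`, which normalizes Jensen's inequality. -/
theorem exists_polynomial_one_sub {μ : Measure ℝ} [IsFiniteMeasure μ] {y : Lp ℂ 2 μ}
    (hy : y ∈ Submodule.span ℂ (expLp μ '' Iic (-1))) :
    ∃ p : Polynomial ℂ, p.coeff 0 = 1 ∧
      ((expLp μ 0 - y : Lp ℂ 2 μ) =ᵐ[μ] fun u => p.eval (circleMap 0 1 (-u))) := by
  have h1 : expMul μ 1 y ∈ Submodule.span ℂ (expLp μ '' Iic 0) := by
    have : Submodule.span ℂ (expLp μ '' Iic (-1)) ≤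
        (Submodule.span ℂ (expLp μ '' Iic 0)).comap (expMul μ 1).toLinearMap := by
      rw [Submodule.span_le]
      rintro _ ⟨s, hs, rfl⟩
      change expMul μ 1 (expLp μ s) ∈ Submodule.span ℂ (expLp μ '' Iic 0)
      rw [expMul_expLp]
      refine Submodule.subset_span (mem_image_of_mem _ ?_)
      simp only [mem_Iic] at hs ⊢
      omega
    exact this hy
  obtain ⟨q, hq⟩ := exists_polynomial_of_mem_span h1
  refine ⟨1 - Polynomial.X * q, by simp, ?_⟩
  filter_upwards [hq, coeFn_expMul 1 y, expLp_zero_coeFn μ, Lp.coeFn_sub (expLp μ 0) y]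
    with u a1 a2 a3 a4
  rw [a4, Pi.sub_apply, a3, Polynomial.eval_sub, Polynomial.eval_one, Polynomial.eval_mul,
    Polynomial.eval_X, ← a1, a2]
  have h2 := circleMap_neg_pow 1 u
  rw [pow_one] at h2
  rw [h2, ← mul_assoc, expI_mul]
  simp

theorem integral_eval_circleMap_neg (p : Polynomial ℂ) :
    ∫ u, p.eval (circleMap 0 1 (-u)) ∂lebIco = 2 * π * p.coeff 0 := by
  simp only [Polynomial.eval_eq_sum_range, circleMap_neg_pow]
  rw [integral_finsetSum]
  · simp only [integral_const_mul, integral_expI_lebIco]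
    rw [Finset.sum_eq_single 0]
    · simp
      ring
    · intro k _ hk
      simp [hk]
    · simp
  · intro k _
    exact ((memLp_expI lebIco (-k : ℤ)).integrable (by norm_num)).const_mul _

/-! ### Jensen's inequality for polynomials -/

theorem ae_eval_circleMap_neg_ne_zero {p : Polynomial ℂ} (hp : p ≠ 0) :
    ∀ᵐ u ∂lebIco, p.eval (circleMap 0 1 (-u)) ≠ 0 := by
  refine ae_restrict_of_ae ?_
  have h : (circleMap 0 1 ⁻¹' (p.rootSet ℂ)).Countable :=
    (p.rootSet_finite ℂ).countable.preimage_circleMap 0 one_ne_zero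
  have h2 := (h.preimage neg_injective).ae_notMem volume
  filter_upwards [h2] with u hu h0
  refine hu ?_
  rw [mem_preimage, mem_preimage, Polynomial.mem_rootSet]
  exact ⟨hp, by simpa using h0⟩

theorem integrable_lebIco_iff {F : ℝ → ℝ} :
    Integrable F lebIco ↔ IntervalIntegrable F volume (-π) π := by
  rw [intervalIntegrable_iff_integrableOn_Ico_of_le (by linarith [Real.pi_pos])]
  rfl

theorem integral_lebIco_eq (F : ℝ → ℝ) : ∫ u, F u ∂lebIco = ∫ u in (-π)..π, F u := by
  rw [intervalIntegral.integral_of_le (by linarith [Real.pi_pos]), integral_Ico_eq_integral_Ioo,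
    ← integral_Ioc_eq_integral_Ioo]

theorem integrable_log_eval (p : Polynomial ℂ) :
    Integrable (fun u : ℝ => Real.log ‖p.eval (circleMap 0 1 (-u))‖) lebIco := by
  have hper : Function.Periodic (fun θ : ℝ => Real.log ‖p.eval (circleMap 0 1 θ)‖) (2 * π) :=
    fun θ => by simp only [periodic_circleMap 0 1 θ]
  rw [integrable_lebIco_iff]
  have h := (hper.intervalIntegrable₀ Real.two_pi_pos.ne'
    p.intervalIntegrable_mahlerMeasure π (-π))
  rw [IntervalIntegrable.iff_comp_neg, neg_neg] at h
  exact h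

/-- Jensen's inequality: the integral is `2π` times the logarithmic Mahler measure, and the
coefficient bound at index `0`, with binomial factor `1`, reads `|p(0)| ≤ M(p)`. -/
theorem two_pi_mul_log_coeff_zero_le {p : Polynomial ℂ} (hp : p.coeff 0 ≠ 0) :
    2 * π * Real.log ‖p.coeff 0‖ ≤
      ∫ u, Real.log ‖p.eval (circleMap 0 1 (-u))‖ ∂lebIco := by
  have hper : Function.Periodic (fun θ : ℝ => Real.log ‖p.eval (circleMap 0 1 θ)‖) (2 * π) :=
    fun θ => by simp only [periodic_circleMap 0 1 θ]
  have h1 : ∫ u, Real.log ‖p.eval (circleMap 0 1 (-u))‖ ∂lebIco =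
      2 * π * p.logMahlerMeasure := by
    rw [integral_lebIco_eq,
      intervalIntegral.integral_comp_neg (fun θ => Real.log ‖p.eval (circleMap 0 1 θ)‖), neg_neg,
      p.logMahlerMeasure_def, Real.circleAverage_def, smul_eq_mul,
      mul_inv_cancel_left₀ Real.two_pi_pos.ne']
    have h := hper.intervalIntegral_add_eq (-π) 0
    rw [zero_add, show -π + 2 * π = π by ring] at h
    exact h
  have h2 := p.norm_coeff_le_choose_mul_mahlerMeasure 0
  rw [Nat.choose_zero_right, Nat.cast_one, one_mul] at h2
  rw [h1, p.logMahlerMeasure_eq_log_MahlerMeasure]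
  exact mul_le_mul_of_nonneg_left (Real.log_le_log (norm_pos_iff.2 hp) h2) Real.two_pi_pos.le

/-! ### The logarithmic integral -/

/-- The separate nonvanishing clause is needed because `Real.log 0 = 0`, whereas the extended
logarithm makes the integral infinite if the density vanishes on a set of positive measure. -/
theorem logIntegral_lt_top_iff (μ : Measure ℝ) [IsFiniteMeasure μ] :
    logIntegral μ < ∞ ↔ (∀ᵐ u ∂lebIco, μ.rnDeriv volume u ≠ 0) ∧
      Integrable (fun u => Real.log (μ.rnDeriv volume u).toReal) lebIco := by
  have hmeas : Measurable fun u => Real.log (μ.rnDeriv volume u).toReal :=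
    (Measure.measurable_rnDeriv μ volume).ennreal_toReal.log
  have htop : ∀ᵐ u ∂lebIco, μ.rnDeriv volume u ≠ ∞ :=
    ae_restrict_of_ae (Measure.rnDeriv_ne_top μ volume)
  have key : (∀ᵐ u ∂lebIco, μ.rnDeriv volume u ≠ 0) →
      logIntegral μ = ∫⁻ u, ‖Real.log (μ.rnDeriv volume u).toReal‖ₑ ∂lebIco := by
    intro h0
    refine lintegral_congr_ae ?_
    filter_upwards [h0, htop] with u h1 h2
    rw [ENNReal.log_pos_real h1 h2, EReal.abs_def, Real.enorm_eq_ofReal_abs]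
  constructor
  · intro h
    have hs : ∀ᵐ u ∂lebIco, μ.rnDeriv volume u ≠ 0 := by
      have hm : MeasurableSet {u | μ.rnDeriv volume u = 0} :=
        Measure.measurable_rnDeriv μ volume (measurableSet_singleton 0)
      by_contra hc
      have hpos : lebIco {u | μ.rnDeriv volume u = 0} ≠ 0 := by
        intro h1
        refine hc ?_
        rw [ae_iff]
        simpa using h1
      have h2 : ∞ * lebIco {u | μ.rnDeriv volume u = 0} ≤ logIntegral μ := by
        rw [← lintegral_indicator_const hm, logIntegral]
        refine lintegral_mono fun u => ?_
        by_cases hu : μ.rnDeriv volume u = 0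
        · rw [hu, ENNReal.log_zero, EReal.abs_bot]
          exact le_top
        · rw [indicator_of_notMem (by exact hu)]
          exact zero_le
      rw [ENNReal.top_mul hpos] at h2
      exact (h2.trans_lt h).ne rfl
    refine ⟨hs, hmeas.aestronglyMeasurable, ?_⟩
    rw [HasFiniteIntegral, ← key hs]
    exact h
  · rintro ⟨h0, hi⟩
    rw [key h0]
    exact hi.2

/-- Weak form of Szegő's theorem: a finite logarithmic integral bounds the prediction error from
below. -/
theorem norm_expLp_zero_sub_sq_ge {μ : Measure ℝ} [IsFiniteMeasure μ]
    (h0 : ∀ᵐ u ∂lebIco, μ.rnDeriv volume u ≠ 0)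
    (hi : Integrable (fun u => Real.log (μ.rnDeriv volume u).toReal) lebIco) {y : Lp ℂ 2 μ}
    (hy : y ∈ Submodule.span ℂ (expLp μ '' Iic (-1))) :
    2 * π * Real.exp ((2 * π)⁻¹ * ∫ u, Real.log (μ.rnDeriv volume u).toReal ∂lebIco) ≤
      ‖expLp μ 0 - y‖ ^ 2 := by
  obtain ⟨p, hp1, hp⟩ := exists_polynomial_one_sub hy
  set x := expLp μ 0 - y
  set Q : ℝ → ℝ := fun u => ‖p.eval (circleMap 0 1 (-u))‖
  have hQc : Continuous Q := (continuous_eval_circleMap_neg p).norm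
  obtain ⟨C, hC⟩ : ∃ C, ∀ u, Q u ≤ C := ⟨_, norm_eval_circleMap_neg_le p⟩
  have hQ0 : ∀ u, 0 ≤ Q u := fun u => norm_nonneg _
  set F : ℝ → ℝ := fun u => (μ.rnDeriv volume u).toReal
  have hQ2 : ∀ u, ‖Q u ^ 2‖ ≤ C ^ 2 := fun u => by
    rw [Real.norm_of_nonneg (by positivity)]
    exact pow_le_pow_left₀ (hQ0 u) (hC u) 2
  have hQi : Integrable (fun u => Q u ^ 2) μ :=
    Integrable.of_bound (by fun_prop) (C ^ 2) (ae_of_all _ hQ2)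
  have hnorm : ‖x‖ ^ 2 = ∫ u, Q u ^ 2 ∂μ := by
    have h1 : ((‖x‖ ^ 2 : ℝ) : ℂ) = ((∫ u, Q u ^ 2 ∂μ : ℝ) : ℂ) := by
      have h2 := inner_self_eq_norm_sq_to_K (𝕜 := ℂ) x
      rw [L2.inner_def] at h2
      rw [← integral_complex_ofReal]
      push_cast
      refine h2.symm.trans (integral_congr_ae ?_)
      filter_upwards [hp] with u hu
      rw [hu, RCLike.inner_apply]
      exact RCLike.mul_conj _
    exact_mod_cast h1
  have hFi : Integrable F volume := Measure.integrable_toReal_rnDeriv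
  have hFQ : Integrable (fun u => F u * Q u ^ 2) volume :=
    hFi.mul_bdd (by fun_prop) (ae_of_all _ hQ2)
  -- The singular part of `μ` only increases the norm and is dropped.
  have hge : ∫ u, F u * Q u ^ 2 ∂lebIco ≤ ∫ u, Q u ^ 2 ∂μ := by
    have h1 : ∫ u, Q u ^ 2 ∂volume.withDensity (μ.rnDeriv volume) ≤ ∫ u, Q u ^ 2 ∂μ :=
      integral_mono_measure (Measure.withDensity_rnDeriv_le μ volume)
        (ae_of_all _ fun u => by positivity) hQi
    rw [integral_withDensity_eq_integral_toReal_smul (Measure.measurable_rnDeriv μ volume)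
      (Measure.rnDeriv_lt_top μ volume)] at h1
    refine le_trans ?_ h1
    exact setIntegral_le_integral hFQ
      (ae_of_all _ fun u => mul_nonneg ENNReal.toReal_nonneg (by positivity))
  set a := Real.exp ((2 * π)⁻¹ * ∫ u, Real.log (F u) ∂lebIco) with ha
  have hapos : 0 < a := Real.exp_pos _
  have hloga : 2 * π * Real.log a = ∫ u, Real.log (F u) ∂lebIco := by
    rw [ha, Real.log_exp, mul_inv_cancel_left₀ Real.two_pi_pos.ne']
  have hp0 : p ≠ 0 := by
    rintro rfl
    simp at hp1
  -- `log x ≤ x - 1` at `x = F Q²/a`, where `a` is the geometric mean of `F`. With this `a` the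
  -- terms in `log a` and `log F` cancel on integration, leaving `a(2π + 2∫ log Q)`, which is at
  -- least `2πa` by Jensen.
  have hpt : ∀ᵐ u ∂lebIco,
      a * ((1 - Real.log a) + (2 * Real.log (Q u) + Real.log (F u))) ≤ F u * Q u ^ 2 := by
    filter_upwards [h0, ae_restrict_of_ae (Measure.rnDeriv_ne_top μ volume),
      ae_eval_circleMap_neg_ne_zero hp0] with u h1 h2 h3
    have hF : 0 < F u := ENNReal.toReal_pos h1 h2
    have hQ : 0 < Q u := norm_pos_iff.2 h3
    have h4 := Real.log_le_sub_one_of_pos (by positivity : 0 < F u * Q u ^ 2 / a)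
    rw [Real.log_div (by positivity) hapos.ne', Real.log_mul hF.ne' (by positivity),
      Real.log_pow] at h4
    have h5 : a * (F u * Q u ^ 2 / a) = F u * Q u ^ 2 := by field_simp
    have h6 := mul_le_mul_of_nonneg_left h4 hapos.le
    push_cast at h6
    nlinarith
  have hlQ : Integrable (fun u => Real.log (Q u)) lebIco := integrable_log_eval p
  have hJ := two_pi_mul_log_coeff_zero_le (p := p) (by rw [hp1]; exact one_ne_zero)
  rw [hp1, norm_one, Real.log_one, mul_zero] at hJ
  have hint := integral_mono_ae
    (((integrable_const (1 - Real.log a)).add ((hlQ.const_mul 2).add hi)).const_mul a)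
    (hFQ.restrict (s := Ico (-π) π)) hpt
  have hsum : ∫ u, a * ((1 - Real.log a) + (2 * Real.log (Q u) + Real.log (F u))) ∂lebIco =
      a * (2 * π + 2 * ∫ u, Real.log (Q u) ∂lebIco) := by
    have h1 : Integrable (fun u => 2 * Real.log (Q u) + Real.log (F u)) lebIco :=
      (hlQ.const_mul 2).add hi
    rw [integral_const_mul, integral_add (integrable_const _) h1,
      integral_add (hlQ.const_mul 2) hi, integral_const_mul, ← hloga, integral_const]
    have h2 : lebIco.real univ = 2 * π := by
      rw [measureReal_restrict_apply_univ, Real.volume_real_Ico_of_le (by linarith [Real.pi_pos])]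
      ring
    rw [h2, smul_eq_mul]
    ring
  change ∫ u, a * ((1 - Real.log a) + (2 * Real.log (Q u) + Real.log (F u))) ∂lebIco ≤ _ at hint
  rw [hsum] at hint
  rw [hnorm]
  refine le_trans ?_ (hint.trans hge)
  nlinarith [mul_nonneg hapos.le hJ]

theorem innov_ne_zero_of_logIntegral_lt_top {μ : Measure ℝ} [IsFiniteMeasure μ]
    (h : logIntegral μ < ∞) : innov μ ≠ 0 := by
  obtain ⟨h0, hi⟩ := (logIntegral_lt_top_iff μ).1 h
  set a := 2 * π * Real.exp ((2 * π)⁻¹ * ∫ u, Real.log (μ.rnDeriv volume u).toReal ∂lebIco)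
  have ha : 0 < a := by positivity
  have hcl : IsClosed {y : Lp ℂ 2 μ | a ≤ ‖expLp μ 0 - y‖ ^ 2} :=
    isClosed_le continuous_const (by fun_prop)
  -- The bound is a closed condition on `y`, so it passes from the algebraic span to the projection
  -- of `1`.
  have h1 : a ≤ ‖expLp μ 0 - (expLp μ 0 - innov μ)‖ ^ 2 :=
    closure_minimal (fun y hy => norm_expLp_zero_sub_sq_ge h0 hi hy) hcl (expLp_sub_innov_mem μ)
  rw [sub_sub_cancel] at h1
  intro h2
  rw [h2, norm_zero] at h1
  norm_num at h1
  linarith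

/-! ### Jensen's inequality for the closed span of `e^{isu}`, `s ≤ 0`, in `L²` of Lebesgue measure -/

theorem integrable_norm_lebIco (x : Lp ℂ 2 lebIco) : Integrable (fun u => ‖x u‖) lebIco :=
  ((Lp.memLp x).integrable (by norm_num)).norm

/-- Adding `ε` makes the logarithm Lipschitz on `[0, ∞)`. This makes the logarithmic integral
continuous on `L²`, so that Jensen's inequality survives passage to the closure. -/
theorem abs_log_add_sub_le {a b ε : ℝ} (ha : 0 ≤ a) (hb : 0 ≤ b) (hε : 0 < ε) :
    |Real.log (a + ε) - Real.log (b + ε)| ≤ ε⁻¹ * |a - b| := by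
  have key : ∀ a b : ℝ, 0 ≤ a → 0 ≤ b →
      Real.log (a + ε) - Real.log (b + ε) ≤ ε⁻¹ * |a - b| := by
    intro a b ha hb
    rw [← Real.log_div (by positivity) (by positivity)]
    refine (Real.log_le_sub_one_of_pos (by positivity)).trans ?_
    have h1 : (a + ε) / (b + ε) - 1 = (b + ε)⁻¹ * (a - b) := by
      field_simp
      ring
    rw [h1]
    refine (mul_le_mul_of_nonneg_left (le_abs_self _) (by positivity)).trans ?_
    exact mul_le_mul_of_nonneg_right (inv_anti₀ hε (by linarith)) (abs_nonneg _)
  rw [abs_le]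
  refine ⟨?_, key a b ha hb⟩
  have := key b a hb ha
  rw [abs_sub_comm] at this
  linarith

theorem integrable_log_norm_add (x : Lp ℂ 2 lebIco) {ε : ℝ} (hε : 0 < ε) :
    Integrable (fun u => Real.log (‖x u‖ + ε)) lebIco := by
  have hm : AEStronglyMeasurable (fun u => Real.log (‖x u‖ + ε)) lebIco :=
    ((Lp.stronglyMeasurable x).measurable.norm.add_const ε).log.aestronglyMeasurable
  refine (((integrable_norm_lebIco x).const_mul ε⁻¹).add
    (integrable_const |Real.log ε|)).mono' hm (ae_of_all _ fun u => ?_)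
  have h := abs_log_add_sub_le (norm_nonneg (x u)) le_rfl hε
  rw [zero_add, sub_zero, abs_norm] at h
  rw [Real.norm_eq_abs, Pi.add_apply]
  have := abs_sub_abs_le_abs_sub (Real.log (‖x u‖ + ε)) (Real.log ε)
  linarith

theorem continuous_integral_log_norm_add {ε : ℝ} (hε : 0 < ε) :
    Continuous fun x : Lp ℂ 2 lebIco => ∫ u, Real.log (‖x u‖ + ε) ∂lebIco := by
  set c := (lebIco univ ^ (1 / (1 : ℝ≥0∞).toReal - 1 / (2 : ℝ≥0∞).toReal)).toReal
  have hc0 : 0 ≤ c := ENNReal.toReal_nonneg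
  -- On a finite measure space the `L¹` norm is controlled by the `L²` norm.
  have hL1 : ∀ z : Lp ℂ 2 lebIco, ∫ u, ‖z u‖ ∂lebIco ≤ c * ‖z‖ := by
    intro z
    have h1 := eLpNorm_le_eLpNorm_mul_rpow_measure_univ (μ := lebIco) (p := 1) (q := 2)
      (by norm_num) (Lp.memLp z).aestronglyMeasurable
    have h2 : lebIco univ ^ (1 / (1 : ℝ≥0∞).toReal - 1 / (2 : ℝ≥0∞).toReal) ≠ ∞ :=
      ENNReal.rpow_ne_top_of_nonneg (by norm_num) (measure_ne_top _ _)
    have h3 := ENNReal.toReal_mono (ENNReal.mul_ne_top (Lp.eLpNorm_ne_top z) h2) h1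
    rw [ENNReal.toReal_mul, ← Lp.norm_def, eLpNorm_one_eq_lintegral_enorm,
      ← integral_norm_eq_lintegral_enorm (Lp.memLp z).aestronglyMeasurable] at h3
    rwa [mul_comm]
  refine (LipschitzWith.of_dist_le_mul (K := ⟨ε⁻¹ * c, by positivity⟩) fun x y => ?_).continuous
  rw [Real.dist_eq, dist_eq_norm, ← integral_sub (integrable_log_norm_add x hε)
    (integrable_log_norm_add y hε)]
  refine (abs_integral_le_integral_abs).trans ?_
  change _ ≤ ε⁻¹ * c * ‖x - y‖
  rw [mul_assoc]
  refine le_trans ?_ (mul_le_mul_of_nonneg_left (hL1 (x - y)) (by positivity))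
  rw [← integral_const_mul]
  refine integral_mono_ae ((integrable_log_norm_add x hε).sub (integrable_log_norm_add y hε)).abs
    ((integrable_norm_lebIco _).const_mul _) ?_
  filter_upwards [Lp.coeFn_sub x y] with u hu
  rw [hu, Pi.sub_apply]
  refine (abs_log_add_sub_le (norm_nonneg _) (norm_nonneg _) hε).trans ?_
  exact mul_le_mul_of_nonneg_left (abs_norm_sub_norm_le _ _) (by positivity)

theorem inner_expLp_zero (x : Lp ℂ 2 lebIco) :
    inner ℂ (expLp lebIco 0) x = ∫ u, x u ∂lebIco := by
  rw [L2.inner_def]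
  refine integral_congr_ae ?_
  filter_upwards [expLp_zero_coeFn lebIco] with u hu
  rw [hu, RCLike.inner_apply, map_one, mul_one]

/-- Jensen's inequality for polynomials, weakened by `ε` so that both sides are continuous in `x`,
then extended to the closed span. -/
theorem norm_mean_le_of_mem_expSpan {x : Lp ℂ 2 lebIco} (hx : x ∈ expSpan lebIco (Iic 0))
    {ε : ℝ} (hε : 0 < ε) : ‖inner ℂ (expLp lebIco 0) x / (2 * π : ℂ)‖ ≤
      Real.exp ((2 * π)⁻¹ * ∫ u, Real.log (‖x u‖ + ε) ∂lebIco) := by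
  have hcl : IsClosed {x : Lp ℂ 2 lebIco | ‖inner ℂ (expLp lebIco 0) x / (2 * π : ℂ)‖ ≤
      Real.exp ((2 * π)⁻¹ * ∫ u, Real.log (‖x u‖ + ε) ∂lebIco)} := by
    refine isClosed_le (by fun_prop) ?_
    exact Real.continuous_exp.comp (continuous_const.mul (continuous_integral_log_norm_add hε))
  refine closure_minimal (fun y hy => ?_) hcl hx
  change ‖inner ℂ (expLp lebIco 0) y / (2 * π : ℂ)‖ ≤
      Real.exp ((2 * π)⁻¹ * ∫ u, Real.log (‖y u‖ + ε) ∂lebIco)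
  obtain ⟨p, hp⟩ := exists_polynomial_of_mem_span hy
  have hπ : (2 * π : ℂ) ≠ 0 := by exact_mod_cast Real.two_pi_pos.ne'
  rw [inner_expLp_zero, integral_congr_ae hp, integral_eval_circleMap_neg,
    mul_div_cancel_left₀ _ hπ]
  by_cases h0 : p.coeff 0 = 0
  · rw [h0, norm_zero]
    positivity
  rw [← Real.log_le_iff_le_exp (norm_pos_iff.2 h0), ← mul_le_mul_iff_right₀ Real.two_pi_pos,
    mul_inv_cancel_left₀ Real.two_pi_pos.ne']
  refine (two_pi_mul_log_coeff_zero_le h0).trans ?_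
  refine integral_mono_ae (integrable_log_eval p) (integrable_log_norm_add y hε) ?_
  have hp0 : p ≠ 0 := by
    rintro rfl
    simp at h0
  filter_upwards [hp, ae_eval_circleMap_neg_ne_zero hp0] with u h1 h2
  rw [h1]
  exact Real.log_le_log (norm_pos_iff.2 h2) (by linarith)

/-- If a function in `L²` without Fourier coefficients of positive index has nonzero mean, then
its logarithm is integrable. -/
theorem integrable_log_norm_of_mem_expSpan {x : Lp ℂ 2 lebIco}
    (hx : x ∈ expSpan lebIco (Iic 0)) (hmean : inner ℂ (expLp lebIco 0) x = (2 * π : ℂ))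
    (hne : ∀ᵐ u ∂lebIco, x u ≠ 0) : Integrable (fun u => Real.log ‖x u‖) lebIco := by
  have hπ : (2 * π : ℂ) ≠ 0 := by exact_mod_cast Real.two_pi_pos.ne'
  have h1 : ∀ ε : ℝ, 0 < ε → 0 ≤ ∫ u, Real.log (‖x u‖ + ε) ∂lebIco := by
    intro ε hε
    have h := norm_mean_le_of_mem_expSpan hx hε
    rw [hmean, div_self hπ, norm_one, Real.one_le_exp_iff] at h
    exact nonneg_of_mul_nonneg_right h (inv_pos.2 Real.two_pi_pos)
  have hxm : Measurable fun u => ‖x u‖ := (Lp.stronglyMeasurable x).measurable.norm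
  let ε : ℕ → ℝ := fun n => 1 / ((n : ℝ) + 1)
  have hε : ∀ n, 0 < ε n := fun n => Nat.one_div_pos_of_nat
  have hε1 : ∀ n, ε n ≤ 1 := fun n => by
    have : (0 : ℝ) ≤ n := n.cast_nonneg
    rw [div_le_one (by positivity)]
    linarith
  -- Since `log y ≤ y - 1` and `ε n ≤ 1`, these functions are nonnegative, and by `h1` their
  -- integrals are at most `∫ |x|`. Fatou's lemma as `ε n → 0` then makes `|x| - log |x|`
  -- integrable.
  let w : ℕ → ℝ → ℝ := fun n u => ‖x u‖ - Real.log (‖x u‖ + ε n)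
  have hwi : ∀ n, Integrable (w n) lebIco := fun n =>
    (integrable_norm_lebIco x).sub (integrable_log_norm_add x (hε n))
  have hw0 : ∀ n u, 0 ≤ w n u := by
    intro n u
    have := Real.log_le_sub_one_of_pos (add_pos_of_nonneg_of_pos (norm_nonneg (x u)) (hε n))
    have := hε1 n
    simp only [w]
    linarith
  have hwl : ∀ n, ∫⁻ u, ENNReal.ofReal (w n u) ∂lebIco ≤
      ENNReal.ofReal (∫ u, ‖x u‖ ∂lebIco) := by
    intro n
    rw [← ofReal_integral_eq_lintegral_ofReal (hwi n) (ae_of_all _ (hw0 n))]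
    refine ENNReal.ofReal_le_ofReal ?_
    rw [integral_sub (integrable_norm_lebIco x) (integrable_log_norm_add x (hε n))]
    linarith [h1 _ (hε n)]
  have hεt : Tendsto ε atTop (𝓝 0) := tendsto_one_div_add_atTop_nhds_zero_nat
  have hlim : ∀ᵐ u ∂lebIco, Tendsto (fun n => ENNReal.ofReal (w n u)) atTop
      (𝓝 (ENNReal.ofReal (‖x u‖ - Real.log ‖x u‖))) := by
    filter_upwards [hne] with u hu
    refine ENNReal.tendsto_ofReal (tendsto_const_nhds.sub ?_)
    have h2 : Tendsto (fun n => ‖x u‖ + ε n) atTop (𝓝 ‖x u‖) := by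
      simpa using (tendsto_const_nhds (x := ‖x u‖)).add hεt
    exact (Real.continuousAt_log (norm_ne_zero_iff.2 hu)).tendsto.comp h2
  have hmw : Measurable fun u => ‖x u‖ - Real.log ‖x u‖ := hxm.sub hxm.log
  have hfin : ∫⁻ u, ENNReal.ofReal (‖x u‖ - Real.log ‖x u‖) ∂lebIco < ∞ := by
    have h2 : ∫⁻ u, ENNReal.ofReal (‖x u‖ - Real.log ‖x u‖) ∂lebIco =
        ∫⁻ u, liminf (fun n => ENNReal.ofReal (w n u)) atTop ∂lebIco := by
      refine lintegral_congr_ae ?_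
      filter_upwards [hlim] with u hu
      rw [hu.liminf_eq]
    rw [h2]
    refine (lintegral_liminf_le fun n => ?_).trans_lt ?_
    · exact (hxm.sub (hxm.add_const _).log).ennreal_ofReal
    · refine (liminf_le_of_le ?_ fun b hb => ?_).trans_lt
        (ENNReal.ofReal_lt_top (r := ∫ u, ‖x u‖ ∂lebIco))
      · isBoundedDefault
      · obtain ⟨n, hn⟩ := hb.exists
        exact hn.trans (hwl n)
  have hw : Integrable (fun u => ‖x u‖ - Real.log ‖x u‖) lebIco := by
    refine ⟨hmw.aestronglyMeasurable, ?_⟩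
    rw [hasFiniteIntegral_iff_ofReal]
    · exact hfin
    · refine ae_of_all _ fun u => ?_
      have := Real.log_le_self (norm_nonneg (x u))
      simp only [Pi.zero_apply]
      linarith
  refine ((integrable_norm_lebIco x).sub hw).congr (ae_of_all _ fun u => ?_)
  simp

/-- A function without Fourier coefficients of positive index is in the closed span of `e^{isu}`,
`s ≤ 0`. -/
theorem mem_expSpan_Iic_zero {x : Lp ℂ 2 lebIco}
    (h : ∀ n : ℤ, 0 < n → inner ℂ (expLp lebIco n) x = 0) : x ∈ expSpan lebIco (Iic 0) := by
  set K := expSpan lebIco (Iic 0)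
  have horth : ∀ n : ℤ, 0 < n → ∀ y ∈ K, inner ℂ (expLp lebIco n) y = 0 := by
    intro n hn y hy
    refine inner_eq_zero_of_mem_expSpan (fun s hs => ?_) hy
    have h1 := integral_expI_lebIco (s - n)
    rw [if_neg (by have := mem_Iic.1 hs; omega)] at h1
    rw [← h1, L2.inner_def]
    refine integral_congr_ae ?_
    filter_upwards [coeFn_expLp lebIco n, coeFn_expLp lebIco s] with u h2 h3
    rw [h2, h3, RCLike.inner_apply, conj_expI, expI_mul]
    rfl
  have h0 : x - K.starProjection x = 0 := by
    refine eq_zero_of_forall_inner_expLp lebIco_compl fun s => ?_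
    rcases le_or_gt s 0 with hs | hs
    · exact (Submodule.mem_orthogonal' _ _).1 (Submodule.sub_starProjection_mem_orthogonal _) _
        (expLp_mem_expSpan _ hs)
    · rw [inner_eq_zero_symm, inner_sub_right, h s hs,
        horth s hs _ (Submodule.starProjection_apply_mem _ _), sub_zero]
  rw [sub_eq_zero] at h0
  rw [h0]
  exact Submodule.starProjection_apply_mem _ _

/-! ### A nonzero innovation forces a finite logarithmic integral -/

theorem logIntegral_lt_top_of_innov_ne_zero {μ : Measure ℝ} [IsFiniteMeasure μ]
    (hμ : μ (Ico (-π) π)ᶜ = 0) (h0 : innov μ ≠ 0) : logIntegral μ < ∞ := by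
  set g := innov μ
  have hgpos : 0 < ‖g‖ := norm_pos_iff.2 h0
  set c := ‖g‖ ^ 2 / (2 * π) with hc
  have hcpos : 0 < c := by positivity
  have hc0 : ENNReal.ofReal c ≠ 0 := by simpa using hcpos
  have hsq : sqMeasure g = ENNReal.ofReal c • lebIco := sqMeasure_innov hμ
  have hlint : ∀ k : ℝ → ℂ, ∫ u, k u ∂lebIco = (c : ℂ)⁻¹ * ∫ u, k u * g u * conj (g u) ∂μ := by
    intro k
    have hcc : (c : ℂ) ≠ 0 := by exact_mod_cast hcpos.ne'
    rw [← integral_sqMeasure, hsq, integral_smul_measure, ENNReal.toReal_ofReal hcpos.le,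
      Complex.real_smul, inv_mul_cancel_left₀ hcc]
  have hgm : Measurable g := (Lp.stronglyMeasurable g).measurable
  have hg0 : ∀ᵐ u ∂lebIco, g u ≠ 0 := by
    have h1 : ∀ᵐ u ∂sqMeasure g, g u ≠ 0 := by
      rw [sqMeasure, ae_withDensity_iff (measurable_enorm_sq _)]
      exact ae_of_all _ fun u hu h => hu (by simp [h])
    rwa [hsq, Measure.ae_ennreal_smul_measure_iff hc0] at h1
  -- `|1/g|²|g|² ≤ 1` is `μ`-integrable, and `|g|² dμ` is a multiple of Lebesgue measure.
  have hGm : MemLp (fun u => (g u)⁻¹) 2 lebIco := by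
    refine (memLp_two_iff_integrable_sq_norm hgm.inv.aestronglyMeasurable).2 ?_
    have h1 : Integrable (fun u => ‖(g u)⁻¹‖ ^ 2) (sqMeasure g) := by
      rw [sqMeasure, integrable_withDensity_iff_integrable_smul' (measurable_enorm_sq g)
        (ae_of_all _ fun u => by simp)]
      refine Integrable.of_bound (by fun_prop) 1 (ae_of_all _ fun u => ?_)
      rw [smul_eq_mul, ENNReal.toReal_pow, toReal_enorm, ← mul_pow, norm_inv,
        Real.norm_of_nonneg (by positivity)]
      exact pow_le_one₀ (by positivity) (mul_inv_le_one)
    rw [hsq] at h1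
    exact (integrable_smul_measure hc0 ENNReal.ofReal_ne_top).1 h1
  set G := hGm.toLp _
  -- Replacing Lebesgue measure by `c⁻¹|g|² dμ` cancels `1/g` against `g` and leaves `conj g`. Thus
  -- orthogonality of `g` to the strict past means that `1/g` has no positive frequencies.
  have hinner : ∀ s : ℤ, inner ℂ (expLp lebIco (-s)) G = (c : ℂ)⁻¹ * inner ℂ g (expLp μ s) := by
    intro s
    have h1 : inner ℂ (expLp lebIco (-s)) G =
        ∫ u : ℝ, Complex.exp (Complex.I * s * u) * (g u)⁻¹ ∂lebIco := by
      rw [L2.inner_def]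
      refine integral_congr_ae ?_
      filter_upwards [coeFn_expLp lebIco (-s), hGm.coeFn_toLp] with u a1 a2
      rw [a1, a2, RCLike.inner_apply, conj_expI, neg_neg, mul_comm]
    rw [h1, hlint, L2.inner_def]
    congr 1
    refine integral_congr_ae ?_
    filter_upwards [coeFn_expLp μ s] with u a1
    rw [a1, RCLike.inner_apply]
    by_cases h : g u = 0
    · simp [h]
    · rw [inv_mul_cancel_right₀ h]
  have hmem : G ∈ expSpan lebIco (Iic 0) := by
    refine mem_expSpan_Iic_zero fun n hn => ?_
    have h1 := hinner (-n)
    rw [neg_neg] at h1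
    rw [h1, inner_innov (expLp_mem_expSpan μ (by simp only [mem_Iic]; omega)), mul_zero]
  have hmean : inner ℂ (expLp lebIco 0) G = (2 * π : ℂ) := by
    have h1 := hinner 0
    rw [neg_zero] at h1
    rw [h1, innov_inner_one, hc]
    have h2 : (‖g‖ : ℂ) ≠ 0 := by exact_mod_cast hgpos.ne'
    have h3 : (π : ℂ) ≠ 0 := by exact_mod_cast Real.pi_ne_zero
    push_cast
    field_simp
    rfl
  have hlogG : Integrable (fun u => Real.log ‖G u‖) lebIco := by
    refine integrable_log_norm_of_mem_expSpan hmem hmean ?_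
    filter_upwards [hGm.coeFn_toLp, hg0] with u a1 a2
    rw [a1]
    exact inv_ne_zero a2
  -- Comparing densities in `|g|² dμ = c du` gives `|g|² f_a = c`.
  have hdens : ∀ᵐ u ∂lebIco, ‖g u‖ₑ ^ 2 * μ.rnDeriv volume u = ENNReal.ofReal c := by
    have h1 : (sqMeasure g).rnDeriv volume =ᵐ[volume] fun u => ‖g u‖ₑ ^ 2 * μ.rnDeriv volume u :=
      Measure.rnDeriv_withDensity_left (measurable_enorm_sq g).aemeasurable
        (ae_of_all _ fun u => by simp)
    have h2 : (sqMeasure g).rnDeriv volume =ᵐ[volume]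
        ENNReal.ofReal c • (Ico (-π) π).indicator 1 := by
      rw [hsq]
      refine (Measure.rnDeriv_smul_left_of_ne_top _ _ ENNReal.ofReal_ne_top).trans ?_
      exact (Measure.rnDeriv_restrict_self volume measurableSet_Ico).const_smul _
    rw [ae_restrict_iff' measurableSet_Ico]
    filter_upwards [h1, h2] with u a1 a2 hu
    rw [← a1, a2, Pi.smul_apply, indicator_of_mem hu, Pi.one_apply, smul_eq_mul, mul_one]
  rw [logIntegral_lt_top_iff]
  constructor
  · filter_upwards [hdens] with u hu h
    rw [h, mul_zero] at hu
    exact hc0 hu.symm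
  · refine ((integrable_const (Real.log c)).add (hlogG.const_mul 2)).congr ?_
    filter_upwards [hdens, hGm.coeFn_toLp, hg0] with u h1 h2 h3
    have h4 := congrArg ENNReal.toReal h1
    rw [ENNReal.toReal_mul, ENNReal.toReal_pow, toReal_enorm, ENNReal.toReal_ofReal hcpos.le] at h4
    have h5 : 0 < ‖g u‖ := norm_pos_iff.2 h3
    have h6 : (μ.rnDeriv volume u).toReal = c * (‖g u‖⁻¹) ^ 2 := by
      rw [← h4]
      field_simp
    rw [Pi.add_apply, h2, h6, norm_inv, Real.log_mul hcpos.ne' (by positivity), Real.log_pow]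
    push_cast
    ring

theorem innov_ne_zero_iff {μ : Measure ℝ} [IsFiniteMeasure μ] (hμ : μ (Ico (-π) π)ᶜ = 0) :
    innov μ ≠ 0 ↔ logIntegral μ < ∞ :=
  ⟨logIntegral_lt_top_of_innov_ne_zero hμ, innov_ne_zero_of_logIntegral_lt_top⟩

/-! ### The criterion -/

theorem respLp_mem_expSpan_iff {μ : Measure ℝ} [IsFiniteMeasure μ] (hμ : μ (Ico (-π) π)ᶜ = 0)
    {ℓ : ℝ → ℂ} (hℓ : Measurable ℓ) (h : logIntegral μ < ∞) (t : ℤ) :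
    respLp hℓ μ ∈ expSpan μ (Iic t) ↔ IsAETrigPoly (resp ℓ) t := by
  constructor
  · intro hm
    exact isAETrigPoly_of_fourier_eq_zero (memLp_resp hℓ lebIco) (conj_resp ℓ) fun n hn =>
      fourier_eq_zero_of_mem_expSpan hμ ((innov_ne_zero_iff hμ).2 h) (memLp_resp hℓ μ)
        (measurable_resp hℓ) (norm_resp_le ℓ) hm hn
  · rintro ⟨b, hb⟩
    have h0 := (innov_ne_zero_iff hμ).2 h
    have hac := lebIco_absolutelyContinuous hμ h0
    set T : Lp ℂ 2 μ := ∑ j ∈ Finset.Icc (-t) t, b j • expLp μ j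
    have hT : T ∈ expSpan μ (Iic t) := Submodule.sum_mem _ fun j hj =>
      Submodule.smul_mem _ _ (expLp_mem_expSpan μ (Finset.mem_Icc.1 hj).2)
    have hd : respLp hℓ μ - T ∈ expSpan μ (Iic t) := by
      -- `η` and the polynomial may differ on the singular part of `μ`; the difference still lies in
      -- the span.
      refine mem_expSpan_of_ae_eq_zero hμ ?_ t
      filter_upwards [hb, hac.ae_le (Lp.coeFn_sub (respLp hℓ μ) T),
        hac.ae_le (memLp_resp hℓ μ).coeFn_toLp,
        hac.ae_le (coeFn_sum_smul_expLp μ b (Finset.Icc (-t) t))] with u a1 a2 a3 a4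
      rw [a2, Pi.sub_apply, respLp, a3, a4, a1, sub_self]
    simpa using add_mem hd hT

theorem not_isAETrigPoly_of_neg {ℓ : ℝ → ℂ} {t : ℤ} (ht : t < 0) :
    ¬ IsAETrigPoly (resp ℓ) t := by
  rintro ⟨b, hb⟩
  have h1 : ∀ᵐ u ∂lebIco, False := by
    filter_upwards [hb] with u hu
    rw [Finset.Icc_eq_empty (by omega), Finset.sum_empty] at hu
    exact resp_ne_zero ℓ u hu
  rw [eventually_false_iff_eq_bot, ae_eq_bot, Measure.restrict_eq_zero, Real.volume_Ico] at h1
  have := Real.pi_pos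
  rw [ENNReal.ofReal_eq_zero] at h1
  linarith

theorem isAETrigPoly_resp_zero_iff {ℓ : ℝ → ℂ} :
    IsAETrigPoly (resp ℓ) 0 ↔ ∃ c : ℝ, ∀ᵐ u ∂lebIco, ‖ℓ u‖ = c := by
  constructor
  · rintro ⟨b, hb⟩
    -- Solves `1/(1 + c²) = b 0` for `c ≥ 0`.
    refine ⟨Real.sqrt ((1 / b 0 - 1 : ℂ).re), ?_⟩
    filter_upwards [hb] with u hu
    simp only [neg_zero, Finset.Icc_self, Finset.sum_singleton, Int.cast_zero, mul_zero, zero_mul,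
      Complex.exp_zero, mul_one] at hu
    rw [← hu, resp, one_div_one_div, add_sub_cancel_left, ← Complex.ofReal_pow, Complex.ofReal_re,
      Real.sqrt_sq (norm_nonneg _)]
  · rintro ⟨c, hc⟩
    refine ⟨fun _ => 1 / (1 + (c : ℂ) ^ 2), ?_⟩
    filter_upwards [hc] with u hu
    simp [resp, hu]

end

theorem theorem5p3 {Ω : Type*} [MeasurableSpace Ω] (P : Measure Ω) [IsProbabilityMeasure P]
    (B : StationarySequence P) (μ : Measure ℝ) [IsFiniteMeasure μ] (hμ : B.IsSpectralMeasure μ)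
    (ℓ : ℝ → ℂ) (hℓ : Measurable ℓ) (t : ℤ) :
    (B.predictionError hμ ℓ (Set.Iic t) = B.predictionError hμ ℓ Set.univ ↔
      logIntegral μ = ∞ ∨
        (logIntegral μ < ∞ ∧ IsAETrigPoly (fun u => 1 / (1 + (‖ℓ u‖ : ℂ) ^ 2)) t)) ∧
    (logIntegral μ < ∞ → t < 0 →
      B.predictionError hμ ℓ Set.univ < B.predictionError hμ ℓ (Set.Iic t)) ∧
    (logIntegral μ < ∞ → t = 0 →
      (B.predictionError hμ ℓ (Set.Iic t) = B.predictionError hμ ℓ Set.univ ↔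
        ∃ c : ℝ, ∀ᵐ u ∂volume.restrict (Set.Ico (-π) π), ‖ℓ u‖ = c)) := by
  have hfin : logIntegral μ < ∞ →
      (B.predictionError hμ ℓ (Iic t) = B.predictionError hμ ℓ univ ↔
        IsAETrigPoly (resp ℓ) t) := fun h => by
    rw [B.predictionError_univ hμ hℓ, B.predictionError_eq_minError_iff hμ hℓ,
      respLp_mem_expSpan_iff hμ.carried hℓ h]
  refine ⟨?_, fun h ht => ?_, fun h ht => ?_⟩
  · rcases eq_or_ne (logIntegral μ) ∞ with h | h
    · refine iff_of_true ?_ (Or.inl h)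
      have h0 : innov μ = 0 := by
        by_contra hne
        exact (logIntegral_lt_top_of_innov_ne_zero hμ.carried hne).ne h
      rw [B.predictionError_univ hμ hℓ, B.predictionError_eq_minError_iff hμ hℓ,
        expSpan_Iic_eq_top hμ.carried h0]
      trivial
    · rw [hfin h.lt_top]
      exact ⟨fun hp => Or.inr ⟨h.lt_top, hp⟩, fun hp => (hp.resolve_left h).2⟩
  · refine lt_of_le_of_ne ?_ fun he => not_isAETrigPoly_of_neg ht ((hfin h).1 he.symm)
    rw [B.predictionError_univ hμ hℓ]
    exact B.minError_le_predictionError hμ hℓ _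
  · subst ht
    rw [hfin h, isAETrigPoly_resp_zero_iff]
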